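/- A digraph is a finite vertex set together with a set of ordered pairs of distinct vertices (its edges); its minimum semi-degree $\delta^0(D)$ is the minimum of all in- and outdegrees of its vertices. For $p\in[0,1]$, $D(n,p)$ denotes the random digraph on $[n]=\{1,\dots,n\}$ in which each of the $n(n-1)$ possible edges is present with probability $p$, independently of all the others. For $k\ge 3$, an orientation of a cycle of length $k$ is a digraph obtained from the undirected cycle on $k$ vertices by giving each of its $k$ edges one of its two directions; for $k=2$ the only one is the digraph on two vertices $u,v$ with both edges $(u,v)$ and $(v,u)$. **Theorem 1.3.** For every $\alpha>0$ there is a constant $C=C(\alpha)>0$ such that the following holds. For every $\varepsilon>0$ there is an $N$ such that, for every $n\ge N$ and every digraph $D_0$ on the vertex set $[n]$ with $\delta^0(D_0)\ge\alpha n$, with probability at least $1-\varepsilon$ the digraph $D_0\cup D(n,\min\{1,C/n\})$ contains, simultaneously for all $k$ with $2\le k\le n$, a copy of every orientation of a cycle of length $k$ (as a not necessarily induced subdigraph). -/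

import Mathlib

namespace PerturbedDigraph

open MeasureTheory ProbabilityTheory

/-- Mathlib's digraphs are arbitrary relations; a digraph here has no loops, i.e. its edges are
ordered pairs of distinct vertices. -/
def Loopless {V : Type*} (D : Digraph V) : Prop := ∀ v, ¬ D.Adj v v

/-- The outdegree of `v`, the number of `w` with an edge from `v` to `w`. -/
noncomputable def outDegree {V : Type*} (D : Digraph V) (v : V) : ℕ := {w | D.Adj v w}.ncard

/-- The indegree of `v`, the number of `w` with an edge from `w` to `v`. -/
noncomputable def inDegree {V : Type*} (D : Digraph V) (v : V) : ℕ := {w | D.Adj w v}.ncard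

/-- The minimum semi-degree, the minimum of all in- and outdegrees. (It is `0` when there is no
vertex.) -/
noncomputable def minSemidegree {V : Type*} (D : Digraph V) : ℕ :=
  ⨅ v : V, min (outDegree D v) (inDegree D v)

/-- `D` contains a copy of `H` as a (not necessarily induced) subdigraph. -/
def Contains {V W : Type*} (D : Digraph V) (H : Digraph W) : Prop :=
  ∃ f : W ↪ V, ∀ u v, H.Adj u v → D.Adj (f u) (f v)

/-- The `i`-th edge of the cycle `(0, 1, …, k - 1)` of length `k`, which joins `i` and `i + 1`
(modulo `k`), directed forwards if `σ i` is true and backwards if it is false. -/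
def cycleEdge {k : ℕ} (σ : ZMod k → Bool) (i : ZMod k) : ZMod k × ZMod k :=
  if σ i then (i, i + 1) else (i + 1, i)

/-- The digraph whose edges are the `cycleEdge σ i`. -/
def cycleDigraph {k : ℕ} (σ : ZMod k → Bool) : Digraph (ZMod k) where
  Adj u v := ∃ i, cycleEdge σ i = (u, v)

/-- The sign pattern `σ` gives an orientation of the cycle of length `k`: the `k` directed edges
are distinct, so that they form a digraph with `k` edges. This holds for every `σ` if `3 ≤ k`; for
`k = 2` it says that the two edges between the two vertices are directed oppositely, as
parallel edges in the same direction do not exist in a digraph. -/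
def IsOrientation {k : ℕ} (σ : ZMod k → Bool) : Prop := Function.Injective (cycleEdge σ)

/-- `D` contains every orientation of a cycle of every length from `2` to `n`. -/
def ContainsAllOrientedCycles {V : Type*} (D : Digraph V) (n : ℕ) : Prop :=
  ∀ k : ℕ, 2 ≤ k → k ≤ n → ∀ σ : ZMod k → Bool, IsOrientation σ → Contains D (cycleDigraph σ)

/-- The set of edges of a digraph. -/
def edgeSet {V : Type*} (D : Digraph V) : Set (V × V) := {e | D.Adj e.1 e.2}

/-- The digraph with a given set of edges. -/
def ofEdgeSet {V : Type*} (E : Set (V × V)) : Digraph V where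
  Adj u v := (u, v) ∈ E

/-- The σ-algebra on digraphs generated by the events that a given edge is present; for finite `V`
it contains every set of digraphs. -/
instance instMeasurableSpaceDigraph {V : Type*} : MeasurableSpace (Digraph V) :=
  MeasurableSpace.comap edgeSet inferInstance

/-- The law of the binomial random digraph on `V`: each ordered pair of distinct vertices is an
edge with probability `p`, independently of all others. -/
noncomputable def binomialDigraph (V : Type*) (p : unitInterval) : Measure (Digraph V) :=
  (setBernoulli {e : V × V | e.1 ≠ e.2} p).map ofEdgeSet

/-- The number `C / n`, cut off to the interval `[0, 1]`; for `0 < C ≤ n` it is `C / n`. -/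
noncomputable def edgeProb (C : ℝ) (n : ℕ) : unitInterval :=
  Set.projIcc (0 : ℝ) 1 zero_le_one (C / n)

end PerturbedDigraph

namespace PerturbedDigraph

open MeasureTheory ProbabilityTheory

/-! The random edges serve two purposes only. For `C = 3 * M ^ 2`, with `M` a large constant
depending on `α`, a union bound over at most `4 ^ n` pairs of sets shows that with high probability
a random edge runs from `A` to `B` for all disjoint `A`, `B` of size at least `g ≈ n / M`. Also,
with high probability some random edge reverses an edge of `D₀`, which gives the cycle of length 2.
The rest is deterministic: `IsRich` records the degree bound `d` and the edges between large sets,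
and `IsRich.exists_cycle` derives every orientation of every length from 3 to `n`. If `k + 2 * g ≤
d`, a greedy path is closed by a connection of length 3.

Longer cycles need absorption. Depth first search (`IsRich.exists_long_path`) covers all but `3 * g`
vertices of a set by a path with any prescribed directions, so the difficulty is to use the
remaining vertices and to close the cycle. An absorber consists of three triples `(a₁, x₁, b₁)`,
`(a₂, x₂, b₂)`, `(a₃, y, b₃)` on a path, all with directions `s`, `t`, such that `x₁` also fits into
the second triple and `x₂` into the third. If `x` fits between `a₁` and `b₁`, the middles `x₁, x₂,
y` can be replaced by `x, x₁, x₂`: the directions are kept, `x` is absorbed and `y` is released. The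
number of uncovered vertices does not change, but there is now a choice which vertices are
uncovered, and they are chosen to form a path that closes the cycle (`IsRich.exists_released_path`).

For this, every `x` and every vertex `v` need many absorbers that accept `x` and release a neighbour
of `v`, in each direction. The middle triple decouples `x` from `y`: `IsRich.exists_gadget`
completes any pair `(a₁, b₁)` with many common middle vertices and any `y` that is not bad to an
absorber. So it suffices to select disjoint triples `(a₁, b₁, y)` that serve all pairs `x, v`; a
random choice would do, and `exists_disjoint_tuples_potential` derandomises it. Bad vertices, which
have few suitable pairs around them, are few (`IsRich.card_bad`) and are placed on the absorbing
path in advance. As the directions are arbitrary, the path is cut into blocks of five vertices, and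
pigeonhole provides many blocks with the same `s`, `t`. -/

/-! ### Choosing disjoint tuples: greedily and by a potential. -/

/-- Greedy choice of pairwise disjoint injective tuples avoiding a given set. -/
theorem exists_disjoint_tuples {V ι κ : Type*} [DecidableEq V] [Fintype ι] [Fintype κ]
    (good : ι → (κ → V) → Prop) (F₀ : Finset V)
    (h : ∀ i, ∀ F : Finset V, F.card ≤ F₀.card + Fintype.card κ * Fintype.card ι →
      ∃ f : κ → V, Function.Injective f ∧ (∀ u, f u ∉ F) ∧ good i f) :
    ∃ L : ι → κ → V, Function.Injective (fun p : ι × κ => L p.1 p.2) ∧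
      (∀ i u, L i u ∉ F₀) ∧ ∀ i, good i (L i) := by
  classical
  have key : ∀ S : Finset ι, ∃ L : ι → κ → V,
      (∀ i ∈ S, ∀ j ∈ S, ∀ u w, L i u = L j w → i = j ∧ u = w) ∧
      (∀ i ∈ S, ∀ u, L i u ∉ F₀) ∧ ∀ i ∈ S, good i (L i) := by
    intro S
    induction S using Finset.induction_on with
    | empty =>
      by_cases hι : Nonempty ι
      · obtain ⟨i⟩ := hι
        obtain ⟨f, -⟩ := h i ∅ (by simp)
        exact ⟨fun _ => f, by simp, by simp, by simp⟩
      · exact ⟨fun i => (hι ⟨i⟩).elim, by simp, by simp, by simp⟩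
    | insert i S hi ih =>
      obtain ⟨L, h1, h2, h3⟩ := ih
      obtain ⟨f, f1, f2, f3⟩ := h i (F₀ ∪ (S ×ˢ Finset.univ).image (fun p : ι × κ => L p.1 p.2)) (by
        refine (Finset.card_union_le _ _).trans (Nat.add_le_add_left ?_ _)
        refine Finset.card_image_le.trans ?_
        rw [Finset.card_product, mul_comm]
        exact Nat.mul_le_mul le_rfl (Finset.card_le_univ S))
      have f2' : ∀ u, f u ∉ F₀ := fun u hu => f2 u (Finset.mem_union_left _ hu)
      have f2'' : ∀ u, ∀ j ∈ S, ∀ w, L j w ≠ f u := fun u j hj w e => f2 u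
        (Finset.mem_union_right _ (Finset.mem_image.2 ⟨(j, w), by simpa using hj, e⟩))
      have hne : ∀ j ∈ S, j ≠ i := fun j hj e => hi (e ▸ hj)
      refine ⟨Function.update L i f, ?_, ?_, ?_⟩
      · intro a ha b hb u w e
        rcases Finset.mem_insert.1 ha with rfl | ha' <;>
          rcases Finset.mem_insert.1 hb with rfl | hb'
        · simp only [Function.update_self] at e
          exact ⟨rfl, f1 e⟩
        · rw [Function.update_self, Function.update_of_ne (hne b hb')] at e
          exact (f2'' u b hb' w e.symm).elim
        · rw [Function.update_self, Function.update_of_ne (hne a ha')] at e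
          exact (f2'' w a ha' u e).elim
        · rw [Function.update_of_ne (hne a ha'), Function.update_of_ne (hne b hb')] at e
          exact h1 a ha' b hb' u w e
      · intro a ha u
        rcases Finset.mem_insert.1 ha with rfl | ha
        · simpa using f2' u
        · rw [Function.update_of_ne (hne a ha)]; exact h2 a ha u
      · intro a ha
        rcases Finset.mem_insert.1 ha with rfl | ha
        · simpa using f3
        · rw [Function.update_of_ne (hne a ha)]; exact h3 a ha
  obtain ⟨L, h1, h2, h3⟩ := key Finset.univ
  refine ⟨L, ?_, fun i => h2 i (Finset.mem_univ _), fun i => h3 i (Finset.mem_univ _)⟩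
  rintro ⟨i, u⟩ ⟨j, w⟩ e
  obtain ⟨rfl, rfl⟩ := h1 i (Finset.mem_univ _) j (Finset.mem_univ _) u w e
  rfl

open Classical in
/-- Choice of pairwise disjoint tuples, one after the other, that reduces the potential
`∑ k, 2 ^ (-#{i | H k (L i)})` in each step by a constant factor. -/
theorem exists_disjoint_tuples_potential {V K κ : Type*} [Fintype V] [Fintype K]
    [Fintype κ] [Nonempty K] [Nonempty V] (H : K → (κ → V) → Prop)
    (hinj : ∀ k f, H k f → Function.Injective f) (m : ℕ) (β : ℝ) (hβ : 0 < β)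
    (hH : ∀ F : Finset V, F.card ≤ Fintype.card κ * m → ∀ k,
      β * Fintype.card (κ → V) ≤
        ((Finset.univ.filter fun f : κ → V => (∀ u, f u ∉ F) ∧ H k f).card : ℝ)) :
    ∀ l ≤ m, ∃ L : Fin l → κ → V, Function.Injective (fun p : Fin l × κ => L p.1 p.2) ∧
      (∀ i, ∃ k, H k (L i)) ∧
      ∑ k, (1 / 2 : ℝ) ^ (Finset.univ.filter fun i => H k (L i)).card ≤
        Fintype.card K * (1 - β / 2) ^ l := by
  intro l
  induction l with
  | zero =>
    intro _
    refine ⟨fun i => i.elim0, ?_, fun i => i.elim0, ?_⟩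
    · rintro ⟨i, _⟩; exact i.elim0
    · simp
  | succ l ih =>
    intro hl
    obtain ⟨L, h1, h2, h3⟩ := ih (by omega)
    set w : K → ℝ := fun k => (1 / 2 : ℝ) ^ (Finset.univ.filter fun i => H k (L i)).card with hw
    have hwpos : ∀ k, 0 < w k := fun k => by positivity
    have hWpos : 0 < ∑ k, w k := Finset.sum_pos (fun k _ => hwpos k) Finset.univ_nonempty
    set F : Finset V := Finset.univ.image (fun p : Fin l × κ => L p.1 p.2) with hF
    have hFc : F.card ≤ Fintype.card κ * m := by
      refine Finset.card_image_le.trans ?_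
      rw [Finset.card_univ, Fintype.card_prod, Fintype.card_fin, mul_comm]
      exact Nat.mul_le_mul le_rfl (by omega)
    -- Averaging over all tuples: some `f` satisfies conditions of total weight at least `β * ∑ k, w
    -- k`. Tuples meeting `F` count as zero, so this `f` avoids `F`. The weights of the conditions
    -- it satisfies are halved.
    have hsum : ∑ _f : κ → V, β * ∑ k, w k ≤ ∑ f : κ → V,
        if (∀ u, f u ∉ F) then ∑ k, (if H k f then w k else 0) else 0 := by
      calc ∑ _f : κ → V, β * ∑ k, w k = ∑ k, w k * (β * Fintype.card (κ → V)) := by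
            rw [Finset.sum_const, Finset.card_univ, nsmul_eq_mul, ← Finset.sum_mul]; ring
        _ ≤ ∑ k, w k * ((Finset.univ.filter fun f : κ → V => (∀ u, f u ∉ F) ∧ H k f).card : ℝ) :=
            Finset.sum_le_sum fun k _ => mul_le_mul_of_nonneg_left (hH F hFc k) (hwpos k).le
        _ = ∑ k, ∑ f : κ → V, if (∀ u, f u ∉ F) ∧ H k f then w k else 0 := by
            refine Finset.sum_congr rfl fun k _ => ?_
            rw [← Finset.sum_filter, Finset.sum_const, nsmul_eq_mul, mul_comm]
        _ = _ := by
            rw [Finset.sum_comm]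
            refine Finset.sum_congr rfl fun f _ => ?_
            split_ifs with hf
            · simp [hf]
            · simp [hf]
    obtain ⟨f, -, hf⟩ := Finset.exists_le_of_sum_le Finset.univ_nonempty hsum
    have hpos : 0 < β * ∑ k, w k := mul_pos hβ hWpos
    have hav : ∀ u, f u ∉ F := by
      by_contra hc
      rw [if_neg hc] at hf
      linarith
    rw [if_pos hav] at hf
    have hex : ∃ k, H k f := by
      by_contra hc
      push Not at hc
      rw [Finset.sum_eq_zero (fun k _ => if_neg (hc k))] at hf
      linarith
    have hfi : Function.Injective f := hinj _ _ hex.choose_spec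
    have hav' : ∀ u i v, f u ≠ L i v := fun u i v e =>
      hav u (Finset.mem_image.2 ⟨(i, v), Finset.mem_univ _, e.symm⟩)
    refine ⟨Fin.cons f L, ?_, ?_, ?_⟩
    · rintro ⟨i, u⟩ ⟨j, v⟩ e
      induction i using Fin.cases <;> induction j using Fin.cases <;>
        simp only [Fin.cons_zero, Fin.cons_succ] at e
      · rw [hfi e]
      · exact (hav' _ _ _ e).elim
      · exact (hav' _ _ _ e.symm).elim
      · have := h1 (a₁ := (_, _)) (a₂ := (_, _)) e
        simp only [Prod.mk.injEq] at this
        rw [this.1, this.2]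
    · intro i
      induction i using Fin.cases
      · simpa using hex
      · simpa using h2 _
    · calc ∑ k, (1 / 2 : ℝ) ^ (Finset.univ.filter fun i => H k ((Fin.cons f L : Fin (l+1) → κ → V) i)).card
          = ∑ k, (w k - (1 / 2) * (if H k f then w k else 0)) := by
            refine Finset.sum_congr rfl fun k _ => ?_
            rw [Fin.card_filter_univ_succ]
            simp only [Fin.cons_zero, Fin.cons_succ, hw]
            split_ifs
            · rw [pow_succ]; ring
            · ring
        _ = ∑ k, w k - (1 / 2) * ∑ k, (if H k f then w k else 0) := by
            rw [Finset.sum_sub_distrib, Finset.mul_sum]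
        _ ≤ (1 - β / 2) * ∑ k, w k := by linarith
        _ ≤ (1 - β / 2) * (Fintype.card K * (1 - β / 2) ^ l) := by
            -- The factor is nonnegative because `hH` with `F = ∅` forces `β ≤ 1`.
            refine mul_le_mul_of_nonneg_left h3 ?_
            obtain ⟨k⟩ := ‹Nonempty K›
            have h5 := hH ∅ (by simp) k
            have h6 : ((Finset.univ.filter fun f : κ → V => (∀ u, f u ∉ (∅ : Finset V)) ∧ H k f).card : ℝ)
              ≤ Fintype.card (κ → V) := by exact_mod_cast Finset.card_le_univ _
            have h7 : (0 : ℝ) < Fintype.card (κ → V) := by exact_mod_cast Fintype.card_pos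
            nlinarith
        _ = _ := by rw [pow_succ]; ring

open Classical in
/-- Choice of pairwise disjoint tuples that satisfy each of the conditions `H k` many times. -/
theorem exists_disjoint_tuples_quota {V K κ : Type*} [Fintype V] [Fintype K]
    [Fintype κ] [Nonempty K] [Nonempty V] (H : K → (κ → V) → Prop)
    (hinj : ∀ k f, H k f → Function.Injective f) (m q : ℕ) (β : ℝ) (hβ : 0 < β)
    (hH : ∀ F : Finset V, F.card ≤ Fintype.card κ * m → ∀ k,
      β * Fintype.card (κ → V) ≤
        ((Finset.univ.filter fun f : κ → V => (∀ u, f u ∉ F) ∧ H k f).card : ℝ))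
    (hq : Fintype.card K * (1 - β / 2) ^ m < (1 / 2 : ℝ) ^ q) :
    ∃ L : Fin m → κ → V, Function.Injective (fun p : Fin m × κ => L p.1 p.2) ∧
      (∀ i, ∃ k, H k (L i)) ∧ ∀ k, q ≤ (Finset.univ.filter fun i => H k (L i)).card := by
  obtain ⟨L, h1, h2, h3⟩ := exists_disjoint_tuples_potential H hinj m β hβ hH m le_rfl
  refine ⟨L, h1, h2, fun k => ?_⟩
  have h4 : (1 / 2 : ℝ) ^ (Finset.univ.filter fun i => H k (L i)).card < (1 / 2 : ℝ) ^ q :=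
    lt_of_le_of_lt ((Finset.single_le_sum (f := fun k => (1 / 2 : ℝ) ^
      (Finset.univ.filter fun i => H k (L i)).card) (fun _ _ => by positivity)
      (Finset.mem_univ k)).trans h3) hq
  exact ((pow_lt_pow_iff_right_of_lt_one₀ (by norm_num) (by norm_num)).1 h4).le

/-! ### Rich digraphs and short connections. -/

open Classical in
/-- The out-neighbours of `u` under the relation `E`. -/
noncomputable def nbr {V : Type*} [Fintype V] (E : V → V → Prop) (u : V) : Finset V :=
  Finset.univ.filter (E u)

@[simp] theorem mem_nbr {V : Type*} [Fintype V] {E : V → V → Prop} {u v : V} :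
    v ∈ nbr E u ↔ E u v := by simp [nbr]

/-- The relations `E true` and `E false` are the edge relation of a digraph and its reverse; all
degrees are at least `d`, and there are edges between any two disjoint sets of size `g`. -/
structure IsRich {V : Type*} [Fintype V] (E : Bool → V → V → Prop) (d g : ℕ) : Prop where
  symm : ∀ {s u v}, E s u v → E (!s) v u
  le_degree : ∀ s u, d ≤ (nbr (E s) u).card
  exists_edge : ∀ s (A B : Finset V), Disjoint A B → g ≤ A.card → g ≤ B.card →
    ∃ a ∈ A, ∃ b ∈ B, E s a b
  pos : 1 ≤ g

variable {V : Type*} {E : Bool → V → V → Prop} {d g : ℕ}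

theorem IsRich.symm' [Fintype V] (hE : IsRich E d g) {s u v} (h : E (!s) u v) : E s v u := by
  simpa using hE.symm h

/-- Disjointness can be dropped at the price of a factor 2: removing a `g`-subset of `A` from `B`
leaves at least `g` vertices. -/
theorem IsRich.exists_edge_of_two_mul_le [Fintype V] [DecidableEq V] (hE : IsRich E d g) (s : Bool) (A B : Finset V)
    (hA : g ≤ A.card) (hB : 2 * g ≤ B.card) : ∃ a ∈ A, ∃ b ∈ B, a ≠ b ∧ E s a b := by
  obtain ⟨A', hA', hc⟩ := Finset.exists_subset_card_eq hA
  have : g ≤ (B \ A').card := by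
    have := Finset.le_card_sdiff A' B
    omega
  obtain ⟨a, ha, b, hb, h⟩ := hE.exists_edge s A' (B \ A') Finset.disjoint_sdiff hc.ge this
  refine ⟨a, hA' ha, b, (Finset.mem_sdiff.1 hb).1, ?_, h⟩
  rintro rfl
  exact (Finset.mem_sdiff.1 hb).2 ha

theorem card_sdiff_nbr [Fintype V] [DecidableEq V] (hE : IsRich E d g) (s : Bool) (u : V) (F : Finset V) :
    d - F.card ≤ (nbr (E s) u \ F).card := by
  have := Finset.le_card_sdiff F (nbr (E s) u)
  have := hE.le_degree s u
  omega

/-- Any two vertices are joined by paths of length `3` with arbitrary directions. -/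
theorem IsRich.exists_connection [Fintype V] [DecidableEq V] (hE : IsRich E d g) (s₁ s₂ s₃ : Bool) (u v : V) (F : Finset V)
    (hF : F.card + 2 * g ≤ d) :
    ∃ x y, x ≠ y ∧ x ∉ F ∧ y ∉ F ∧ E s₁ u x ∧ E s₂ x y ∧ E s₃ y v := by
  have h1 := card_sdiff_nbr hE s₁ u F
  have h2 := card_sdiff_nbr hE (!s₃) v F
  obtain ⟨x, hx, y, hy, hxy, h⟩ := hE.exists_edge_of_two_mul_le s₂ (nbr (E s₁) u \ F)
    (nbr (E (!s₃)) v \ F) (by omega) (by omega)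
  simp only [Finset.mem_sdiff, mem_nbr] at hx hy
  exact ⟨x, y, hxy, hx.2, hy.2, hx.1, h, hE.symm' hy.1⟩

theorem IsRich.exists_nbr [Fintype V] [DecidableEq V] (hE : IsRich E d g) (s : Bool) (u : V) (F : Finset V)
    (hF : F.card < d) : ∃ x, x ∉ F ∧ E s u x := by
  have h1 := card_sdiff_nbr hE s u F
  obtain ⟨x, hx⟩ := Finset.card_pos.1 (show 0 < (nbr (E s) u \ F).card by omega)
  simp only [Finset.mem_sdiff, mem_nbr] at hx
  exact ⟨x, hx.2, hx.1⟩

/-! ### Long paths by depth first search. -/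

/-- The list `l`, read from its end, is a path with the directions `τ` that starts in `S`. -/
def IsPatternPath (E : Bool → V → V → Prop) (τ : ℕ → Bool) (S : Finset V) : List V → Prop
  | [] => True
  | [x] => x ∈ S
  | y :: x :: l => E (τ l.length) x y ∧ IsPatternPath E τ S (x :: l)

theorem IsPatternPath.tail {τ : ℕ → Bool} {S : Finset V} {x : V} {l : List V}
    (h : IsPatternPath E τ S (x :: l)) : IsPatternPath E τ S l := by
  cases l with
  | nil => trivial
  | cons y l => exact h.2

theorem IsPatternPath.exists_fun {τ : ℕ → Bool} {S : Finset V} {l : List V}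
    (h : IsPatternPath E τ S l) (hl : l.Nodup) (hne : l ≠ []) :
    ∃ p : ℕ → V, Set.InjOn p (Set.Iio l.length) ∧ (∀ i < l.length, p i ∈ l) ∧ p 0 ∈ S ∧
      (p (l.length - 1) = l.head hne) ∧ ∀ i, i + 1 < l.length → E (τ i) (p i) (p (i + 1)) := by
  induction l with
  | nil => exact (hne rfl).elim
  | cons y l ih =>
    cases l with
    | nil =>
      refine ⟨fun _ => y, ?_, by simp, h, by simp, by simp⟩
      intro a ha b hb _
      simp only [List.length_cons, List.length_nil, Set.mem_Iio] at ha hb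
      omega
    | cons x l =>
      obtain ⟨p, p1, p2, p3, p4, p5⟩ := ih h.2 hl.tail (by simp)
      have hy : y ∉ x :: l := (List.nodup_cons.1 hl).1
      set L := (x :: l).length with hL
      have hL' : L = l.length + 1 := by simp [hL]
      have hlen : (y :: x :: l).length = L + 1 := by simp [hL]
      rw [hlen]
      refine ⟨Function.update p L y, ?_, ?_, ?_, ?_, ?_⟩
      · intro a ha b hb e
        simp only [Set.mem_Iio] at ha hb
        by_cases h1 : a = L <;> by_cases h2 : b = L
        · omega
        · subst h1
          rw [Function.update_self, Function.update_of_ne h2] at e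
          exact (hy (e ▸ p2 b (by omega))).elim
        · subst h2
          rw [Function.update_self, Function.update_of_ne h1] at e
          exact (hy (e ▸ p2 a (by omega))).elim
        · rw [Function.update_of_ne h1, Function.update_of_ne h2] at e
          exact p1 (show a < L by omega) (show b < L by omega) e
      · intro i hi
        by_cases h1 : i = L
        · subst h1; simp
        · rw [Function.update_of_ne h1]
          exact List.mem_cons_of_mem _ (p2 i (by omega))
      · rw [Function.update_of_ne (by omega)]; exact p3
      · simp
      · intro i hi
        rw [Function.update_of_ne (by omega)]
        by_cases h1 : i + 1 = L
        · rw [h1, Function.update_self]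
          have : i = L - 1 := by omega
          rw [this, p4]
          have h2 := h.1
          rwa [show L - 1 = l.length by omega]
        · rw [Function.update_of_ne h1]
          exact p5 i (by omega)

/-- Depth first search: a large set contains long paths with arbitrary directions. -/
theorem IsRich.exists_long_path [Fintype V] [DecidableEq V] (hE : IsRich E d g) (τ : ℕ → Bool) (Z S : Finset V) (L : ℕ)
    (hL : 1 ≤ L) (hSZ : S ⊆ Z) (hS : 2 * g ≤ S.card) (hZ : L + 3 * g ≤ Z.card) :
    ∃ p : ℕ → V, Set.InjOn p (Set.Iio L) ∧ (∀ i < L, p i ∈ Z) ∧ p 0 ∈ S ∧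
      ∀ i, i + 1 < L → E (τ i) (p i) (p (i + 1)) := by
  have hg := hE.pos
  -- State of the search after `N` steps: `l` is the stack, and `D b` holds the vertices popped
  -- because they had no edge of direction `b` to an unexplored vertex. The counter `2 * (|D true| +
  -- |D false|) + |l|` grows by one in each step: a push adds 1, a pop adds 2 and removes 1.
  have key : ∀ N : ℕ, ∃ (l : List V) (D : Bool → Finset V), l.Nodup ∧ IsPatternPath E τ S l ∧
      (∀ x ∈ l, x ∈ Z) ∧ (∀ b, D b ⊆ Z) ∧ l.length ≤ L ∧ (∀ b, (D b).card < g) ∧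
      (∀ b, ∀ x ∈ D b, x ∉ l) ∧
      (∀ b, ∀ x ∈ D b, ∀ u ∈ Z, u ∉ l → (∀ c, u ∉ D c) → ¬ E b x u) ∧
      Disjoint (D true) (D false) ∧
      (l.length = L ∨ N ≤ 2 * ((D true).card + (D false).card) + l.length) := by
    intro N
    induction N with
    | zero =>
      exact ⟨[], fun _ => ∅, by simp, trivial, by simp, by simp, by simp, by simp; omega,
        by simp, by simp, by simp, by simp⟩
    | succ N ih =>
      obtain ⟨l, D, h1, h2, h3, h4, h5, h6, h7, h8, h9, h10⟩ := ih
      by_cases hlL : l.length = L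
      · exact ⟨l, D, h1, h2, h3, h4, h5, h6, h7, h8, h9, Or.inl hlL⟩
      have h10 := h10.resolve_left hlL
      set U : Finset V := Z \ (l.toFinset ∪ (D true ∪ D false)) with hU
      have hmU : ∀ u, u ∈ U ↔ u ∈ Z ∧ u ∉ l ∧ ∀ c, u ∉ D c := by
        intro u; simp [hU]; tauto
      have ht := h6 true
      have hf := h6 false
      have hUc : g ≤ U.card := by
        rw [hU]
        have e1 := Finset.le_card_sdiff (l.toFinset ∪ (D true ∪ D false)) Z
        have e2 := Finset.card_union_le l.toFinset (D true ∪ D false)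
        have e3 := Finset.card_union_le (D true) (D false)
        have e4 := l.toFinset_card_le
        omega
      have push : ∀ u ∈ U, IsPatternPath E τ S (u :: l) →
          ∃ (l : List V) (D : Bool → Finset V), l.Nodup ∧ IsPatternPath E τ S l ∧
          (∀ x ∈ l, x ∈ Z) ∧ (∀ b, D b ⊆ Z) ∧ l.length ≤ L ∧ (∀ b, (D b).card < g) ∧
          (∀ b, ∀ x ∈ D b, x ∉ l) ∧
          (∀ b, ∀ x ∈ D b, ∀ u ∈ Z, u ∉ l → (∀ c, u ∉ D c) → ¬ E b x u) ∧
          Disjoint (D true) (D false) ∧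
          (l.length = L ∨ N + 1 ≤ 2 * ((D true).card + (D false).card) + l.length) := by
        intro u hu hp
        obtain ⟨u1, u2, u3⟩ := (hmU u).1 hu
        refine ⟨u :: l, D, List.nodup_cons.2 ⟨u2, h1⟩, hp, ?_, h4, ?_, h6, ?_, ?_, h9, ?_⟩
        · intro x hx
          rcases List.mem_cons.1 hx with rfl | hx
          · exact u1
          · exact h3 x hx
        · simp only [List.length_cons]; omega
        · intro b x hx hxl
          rcases List.mem_cons.1 hxl with rfl | hxl
          · exact u3 b hx
          · exact h7 b x hx hxl
        · intro b x hx v hv hvl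
          exact h8 b x hx v hv (fun h => hvl (List.mem_cons_of_mem _ h))
        · right; simp only [List.length_cons]; omega
      cases l with
      | nil =>
        have : 0 < (S \ (D true ∪ D false)).card := by
          have e1 := Finset.le_card_sdiff (D true ∪ D false) S
          have e3 := Finset.card_union_le (D true) (D false)
          omega
        obtain ⟨u, hu⟩ := Finset.card_pos.1 this
        simp only [Finset.mem_sdiff, Finset.mem_union, not_or] at hu
        refine push u ((hmU u).2 ⟨hSZ hu.1, by simp, ?_⟩) hu.1
        intro c; cases c
        · exact hu.2.2
        · exact hu.2.1
      | cons x l' =>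
        by_cases hex : ∃ u ∈ U, E (τ l'.length) x u
        · obtain ⟨u, hu, hxu⟩ := hex
          exact push u hu ⟨hxu, h2⟩
        · push Not at hex
          set b := τ l'.length with hb
          have hxD : ∀ c, x ∉ D c := fun c hc => h7 c x hc (by simp)
          have hdead : ∀ y ∈ insert x (D b), ∀ u ∈ U, ¬ E b y u := by
            intro y hy u hu
            rcases Finset.mem_insert.1 hy with rfl | hy
            · exact hex u hu
            · obtain ⟨u1, u2, u3⟩ := (hmU u).1 hu
              exact h8 b y hy u u1 u2 u3
          have hxU : x ∉ U := fun h => ((hmU x).1 h).2.1 (by simp)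
          -- No edge of direction `b` leads from `insert x (D b)` to the unexplored set `U`, which
          -- has at least `g` vertices.
          have hlt : (insert x (D b)).card < g := by
            by_contra hge
            push Not at hge
            obtain ⟨a, ha, u, hu, hau⟩ := hE.exists_edge b (insert x (D b)) U (by
              rw [Finset.disjoint_left]
              intro y hy hyU
              rcases Finset.mem_insert.1 hy with rfl | hy
              · exact hxU hyU
              · exact ((hmU y).1 hyU).2.2 b hy) hge hUc
            exact hdead a ha u hu hau
          have hxl' : x ∉ l' := (List.nodup_cons.1 h1).1
          have hmem : ∀ c y, y ∈ Function.update D b (insert x (D b)) c →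
              (y = x ∧ c = b) ∨ y ∈ D c := by
            intro c y hy
            by_cases hc : c = b
            · subst hc
              rw [Function.update_self] at hy
              rcases Finset.mem_insert.1 hy with rfl | hy
              · exact Or.inl ⟨rfl, rfl⟩
              · exact Or.inr hy
            · rw [Function.update_of_ne hc] at hy
              exact Or.inr hy
          refine ⟨l', Function.update D b (insert x (D b)), h1.tail, h2.tail,
            fun y hy => h3 y (List.mem_cons_of_mem _ hy), ?_, ?_, ?_, ?_, ?_, ?_, ?_⟩
          · intro c y hy
            rcases hmem c y hy with ⟨rfl, -⟩ | hy
            · exact h3 _ (by simp)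
            · exact h4 c hy
          · simp only [List.length_cons] at h5; omega
          · intro c
            by_cases hc : c = b
            · subst hc; simpa using hlt
            · rw [Function.update_of_ne hc]; exact h6 c
          · intro c y hy hyl
            rcases hmem c y hy with ⟨rfl, -⟩ | hy
            · exact hxl' hyl
            · exact h7 c y hy (List.mem_cons_of_mem _ hyl)
          · intro c y hy u hu hul huD
            have hux : u ≠ x := by
              rintro rfl
              exact huD b (by simp)
            have huD' : ∀ c, u ∉ D c := by
              intro c' hc'
              apply huD c'
              by_cases h : c' = b
              · subst h; simp [hc']
              · rwa [Function.update_of_ne h]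
            have hul' : u ∉ x :: l' := by simp [hux, hul]
            rcases hmem c y hy with ⟨rfl, rfl⟩ | hy
            · exact hex u ((hmU u).2 ⟨hu, hul', huD'⟩)
            · exact h8 c y hy u hu hul' huD'
          · rw [Finset.disjoint_left]
            intro y hy hy'
            rcases hmem _ _ hy with ⟨e₁, e⟩ | h₁
            · rcases hmem _ _ hy' with ⟨_, e'⟩ | h₂
              · simp [← e] at e'
              · exact hxD _ (e₁ ▸ h₂)
            · rcases hmem _ _ hy' with ⟨e₁, _⟩ | h₂
              · exact hxD _ (e₁ ▸ h₁)
              · exact Finset.disjoint_left.1 h9 h₁ h₂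
          · right
            simp only [List.length_cons] at h10
            have := Finset.card_insert_of_notMem (hxD b)
            cases hb' : b
            · rw [hb'] at this
              simp only [Function.update_self, ne_eq, Bool.true_eq_false, not_false_eq_true,
                Function.update_of_ne]
              omega
            · rw [hb'] at this
              simp only [Function.update_self, ne_eq, Bool.false_eq_true, not_false_eq_true,
                Function.update_of_ne]
              omega
  -- With both dead sets smaller than `g`, the counter cannot reach `4 * g + L`, so the stack must
  -- have reached length `L`.
  obtain ⟨l, D, h1, h2, h3, -, h5, h6, -, -, -, h10⟩ := key (4 * g + L)
  have hlen : l.length = L := by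
    rcases h10 with h | h
    · exact h
    · have ht := h6 true
      have hf := h6 false
      omega
  obtain ⟨p, p1, p2, p3, -, p5⟩ := h2.exists_fun h1 (by rintro rfl; simp at hlen; omega)
  rw [hlen] at p1 p2 p5
  exact ⟨p, p1, fun i hi => h3 _ (p2 i hi), p3, p5⟩

/-! ### Bad vertices and absorbers. -/

variable {s t : Bool}

/-- `x` can be placed between `a` and `b` on a path with directions `s` and `t`. -/
def Fits (E : Bool → V → V → Prop) (s t : Bool) (a x b : V) : Prop := E s a x ∧ E t x b

open Classical in
/-- The vertices that can be placed between `a` and `b`. -/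
noncomputable def mid [Fintype V] (E : Bool → V → V → Prop) (s t : Bool) (a b : V) : Finset V :=
  Finset.univ.filter fun x => Fits E s t a x b

open Classical in
/-- The pairs around `x` between which at least `c` vertices can be placed. -/
noncomputable def ends [Fintype V] (E : Bool → V → V → Prop) (s t : Bool) (c : ℕ) (x : V) :
    Finset (V × V) :=
  Finset.univ.filter fun p => Fits E s t p.1 x p.2 ∧ c ≤ (mid E s t p.1 p.2).card

open Classical in
/-- The vertices that have few pairs in `ends`. -/
noncomputable def bad [Fintype V] (E : Bool → V → V → Prop) (s t : Bool) (c d : ℕ) : Finset V :=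
  Finset.univ.filter fun x => 2 * (ends E s t c x).card < d ^ 2

theorem mem_mid [Fintype V] {a x b : V} : x ∈ mid E s t a b ↔ Fits E s t a x b := by simp [mid]

/-- Double counting. Around each `x` there are at least `d ^ 2` pairs; if `x` is bad, at least half
of `d ^ 2` of them have fewer than `c` middle vertices. Each of the `|V| ^ 2` pairs is counted in
this way for at most `c` vertices. -/
theorem IsRich.card_bad [Fintype V] [DecidableEq V] (hE : IsRich E d g) (s t : Bool) (c : ℕ) :
    (bad E s t c d).card * d ^ 2 ≤ 2 * Fintype.card V ^ 2 * c := by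
  classical
  set low : V → Finset (V × V) := fun x =>
    Finset.univ.filter fun p => Fits E s t p.1 x p.2 ∧ (mid E s t p.1 p.2).card < c with hlow
  have h1 : ∀ x ∈ bad E s t c d, d ^ 2 ≤ 2 * (low x).card := by
    intro x hx
    simp only [bad, Finset.mem_filter, Finset.mem_univ, true_and] at hx
    have h2 : (nbr (E (!s)) x ×ˢ nbr (E t) x).card ≤ (ends E s t c x).card + (low x).card := by
      refine (Finset.card_le_card ?_).trans (Finset.card_union_le _ _)
      rintro ⟨a, b⟩ hp
      simp only [Finset.mem_product, mem_nbr] at hp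
      have : Fits E s t a x b := ⟨hE.symm' hp.1, hp.2⟩
      simp only [ends, hlow, Finset.mem_union, Finset.mem_filter, Finset.mem_univ, true_and, this]
      exact le_or_gt _ _
    rw [Finset.card_product] at h2
    have h3 := Nat.mul_le_mul (hE.le_degree (!s) x) (hE.le_degree t x)
    nlinarith
  have h4 : ∑ x, (low x).card ≤ Fintype.card V ^ 2 * c := by
    have : ∑ x, (low x).card = ∑ p : V × V,
        ((mid E s t p.1 p.2).filter fun _ => (mid E s t p.1 p.2).card < c).card := by
      simp only [hlow, Finset.card_filter, mid, Finset.sum_filter]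
      rw [Finset.sum_comm]
      refine Finset.sum_congr rfl fun p _ => Finset.sum_congr rfl fun x _ => ?_
      rw [ite_and]
    rw [this]
    refine (Finset.sum_le_card_nsmul _ _ c fun p _ => ?_).trans ?_
    · by_cases h : (mid E s t p.1 p.2).card < c
      · simpa [h] using h.le
      · simp [h]
    · simp [Fintype.card_prod, sq]
  have h5 : (bad E s t c d).card * d ^ 2 ≤ ∑ x ∈ bad E s t c d, 2 * (low x).card := by
    rw [← smul_eq_mul]
    exact Finset.card_nsmul_le_sum _ _ _ h1
  have h6 : ∑ x ∈ bad E s t c d, 2 * (low x).card ≤ ∑ x, 2 * (low x).card :=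
    Finset.sum_le_sum_of_subset (Finset.subset_univ _)
  rw [← Finset.mul_sum] at h5 h6
  rw [← Finset.mul_sum] at h6
  nlinarith

/-- At most `(2 * F.card + 1) * |V|` pairs meet `F` or are diagonal. -/
theorem card_ends_avoiding [Fintype V] [DecidableEq V] {c : ℕ} {x : V} (hx : x ∉ bad E s t c d)
    (F : Finset V) :
    d ^ 2 ≤ 2 * (((ends E s t c x).filter fun p => p.1 ∉ F ∧ p.2 ∉ F ∧ p.1 ≠ p.2).card +
      (2 * F.card + 1) * Fintype.card V) := by
  classical
  simp only [bad, Finset.mem_filter, Finset.mem_univ, true_and, not_lt] at hx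
  have : (ends E s t c x).card ≤
      ((ends E s t c x).filter fun p => p.1 ∉ F ∧ p.2 ∉ F ∧ p.1 ≠ p.2).card +
      (((F ×ˢ (Finset.univ : Finset V)).card + ((Finset.univ : Finset V) ×ˢ F).card) +
        (Finset.univ : Finset V).card) := by
    rw [← Finset.card_filter_add_card_filter_not (s := ends E s t c x)
      (fun p => p.1 ∉ F ∧ p.2 ∉ F ∧ p.1 ≠ p.2)]
    refine Nat.add_le_add_left ?_ _
    rw [← Finset.diag_card (Finset.univ : Finset V)]
    refine (Finset.card_le_card ?_).trans ((Finset.card_union_le _ _).trans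
      (Nat.add_le_add_right (Finset.card_union_le _ _) _))
    rintro ⟨a, b⟩ hp
    simp only [Finset.mem_filter, ne_eq] at hp
    simp only [Finset.mem_union, Finset.mem_product, Finset.mem_univ, and_true, true_and,
      Finset.mem_diag]
    tauto
  simp only [Finset.card_product, Finset.card_univ] at this
  nlinarith

-- There are at least `d ^ 2 / 4` admissible pairs around `x`, and for each of them at least `d / 2`
-- admissible neighbours of `v`. Hence a constant proportion of all triples serves given `x`, `v`
-- and `r`, as the potential argument requires.
open Classical in
theorem IsRich.card_spread_triples [Fintype V] [DecidableEq V] (hE : IsRich E d g) {c m : ℕ}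
    (h1 : (24 * m + 4) * Fintype.card V ≤ d ^ 2)
    (h2 : 2 * ((bad E s t c d).card + 3 * m + 2) ≤ d) (F : Finset V) (hF : F.card ≤ 3 * m)
    {x : V} (hx : x ∉ bad E s t c d) (r : Bool) (v : V) :
    d ^ 3 ≤ 8 * (Finset.univ.filter fun f : Fin 3 → V => (∀ u, f u ∉ F) ∧ Function.Injective f ∧
      c ≤ (mid E s t (f 0) (f 1)).card ∧ f 2 ∉ bad E s t c d ∧
      Fits E s t (f 0) x (f 1) ∧ E r v (f 2)).card := by
  set n := Fintype.card V with hn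
  set P := (ends E s t c x).filter fun p => p.1 ∉ F ∧ p.2 ∉ F ∧ p.1 ≠ p.2 with hP
  have hPc : d ^ 2 ≤ 4 * P.card := by
    have e1 := card_ends_avoiding hx F
    have e2 : (2 * F.card + 1) * n ≤ (6 * m + 1) * n := Nat.mul_le_mul_right _ (by omega)
    rw [← hP, ← hn] at e1
    nlinarith
  set Y : V × V → Finset V := fun p => nbr (E r) v \ (bad E s t c d ∪ F ∪ {p.1, p.2}) with hY
  have hYc : ∀ p ∈ P, (d + 1) / 2 ≤ (Y p).card := by
    intro p _
    have e1 := card_sdiff_nbr hE r v (bad E s t c d ∪ F ∪ {p.1, p.2})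
    have e2 := Finset.card_union_le (bad E s t c d ∪ F) {p.1, p.2}
    have e3 := Finset.card_union_le (bad E s t c d) F
    have e4 := Finset.card_le_two (a := p.1) (b := p.2)
    simp only [hY]
    omega
  have hsig : P.card * ((d + 1) / 2) ≤
      (Finset.univ.filter fun f : Fin 3 → V => (∀ u, f u ∉ F) ∧ Function.Injective f ∧
      c ≤ (mid E s t (f 0) (f 1)).card ∧ f 2 ∉ bad E s t c d ∧
      Fits E s t (f 0) x (f 1) ∧ E r v (f 2)).card := by
    calc P.card * ((d + 1) / 2) ≤ ∑ p ∈ P, (Y p).card := by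
          rw [← smul_eq_mul]; exact Finset.card_nsmul_le_sum _ _ _ hYc
      _ = (P.sigma Y).card := (Finset.card_sigma _ _).symm
      _ ≤ _ := by
          refine Finset.card_le_card_of_injOn (fun z => ![z.1.1, z.1.2, z.2]) ?_ ?_
          · rintro ⟨⟨a, b⟩, y⟩ hz
            simp only [Finset.coe_sigma, Set.mem_sigma_iff, Finset.mem_coe, hP, hY, ends,
              Finset.mem_filter, Finset.mem_univ, true_and, Finset.mem_sdiff, mem_nbr,
              Finset.mem_union, Finset.mem_insert, Finset.mem_singleton, not_or] at hz
            obtain ⟨⟨⟨z1, z2⟩, z3, z4, z5⟩, z6, ⟨z7, z8⟩, z9, z10⟩ := hz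
            simp only [Finset.coe_filter, Finset.mem_univ, true_and, Set.mem_ofPred_eq]
            refine ⟨?_, ?_, z2, z7, z1, z6⟩
            · intro u; fin_cases u <;> assumption
            · intro i j hij
              fin_cases i <;> fin_cases j <;> simp_all
          · rintro ⟨⟨a, b⟩, y⟩ _ ⟨⟨a', b'⟩, y'⟩ _ e
            have e0 := congrFun e 0
            have e1 := congrFun e 1
            have e2 := congrFun e 2
            simp at e0 e1 e2
            subst e0 e1 e2
            rfl
  refine le_trans ?_ (Nat.mul_le_mul_left 8 hsig)
  have : d ≤ 2 * ((d + 1) / 2) := by omega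
  calc d ^ 3 = d ^ 2 * d := by ring
    _ ≤ (4 * P.card) * (2 * ((d + 1) / 2)) := Nat.mul_le_mul hPc this
    _ = _ := by ring

-- The potential argument, applied with one condition for each vertex `x` that is not bad, each `v`
-- and each direction. The selected triples hold the outer vertices of the first triple of an
-- absorber and the vertex that it releases.
open Classical in
theorem IsRich.exists_spread_triples [Fintype V] [Nonempty V] [DecidableEq V] (hE : IsRich E d g)
    {c m q A : ℕ} (hA : Fintype.card V ≤ A * d) (hd : 0 < d)
    (h1 : (24 * m + 4) * Fintype.card V ≤ d ^ 2)
    (h2 : 2 * ((bad E s t c d).card + 3 * m + 2) ≤ d)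
    (hq : 2 * (Fintype.card V : ℝ) ^ 2 * (1 - 1 / (16 * (A : ℝ) ^ 3)) ^ m < (1 / 2 : ℝ) ^ q) :
    ∃ L : Fin m → Fin 3 → V, Function.Injective (fun p : Fin m × Fin 3 => L p.1 p.2) ∧
      (∀ i, c ≤ (mid E s t (L i 0) (L i 1)).card ∧ L i 2 ∉ bad E s t c d) ∧
      ∀ x ∉ bad E s t c d, ∀ r v,
        q ≤ (Finset.univ.filter fun i => Fits E s t (L i 0) x (L i 1) ∧ E r v (L i 2)).card := by
  set n := Fintype.card V with hn
  have hdn : ∀ v : V, d ≤ n := fun v => (hE.le_degree s v).trans (Finset.card_le_univ _)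
  obtain ⟨v₀⟩ := ‹Nonempty V›
  have hA0 : 0 < A := by
    rcases Nat.eq_zero_or_pos A with h | h
    · have := hdn v₀
      subst h
      omega
    · exact h
  obtain ⟨x₀, hx₀⟩ : ∃ x, x ∉ bad E s t c d := by
    by_contra hc
    push Not at hc
    have : (bad E s t c d) = Finset.univ := Finset.eq_univ_iff_forall.2 hc
    rw [this, Finset.card_univ] at h2
    have := hdn v₀
    omega
  let K := {x // x ∉ bad E s t c d} × V × Bool
  let H : K → (Fin 3 → V) → Prop := fun k f => Function.Injective f ∧
    c ≤ (mid E s t (f 0) (f 1)).card ∧ f 2 ∉ bad E s t c d ∧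
    Fits E s t (f 0) k.1 (f 1) ∧ E k.2.2 k.2.1 (f 2)
  have : Nonempty K := ⟨⟨x₀, hx₀⟩, v₀, true⟩
  have : Nonempty V := ⟨v₀⟩
  have hcount : ∀ F : Finset V, F.card ≤ Fintype.card (Fin 3) * m → ∀ k : K,
      1 / (8 * (A : ℝ) ^ 3) * Fintype.card (Fin 3 → V) ≤
        ((Finset.univ.filter fun f : Fin 3 → V => (∀ u, f u ∉ F) ∧ H k f).card : ℝ) := by
    rintro F hF ⟨⟨x, hx⟩, v, r⟩
    rw [Fintype.card_fin] at hF
    have h8 := hE.card_spread_triples h1 h2 F hF hx r v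
    have h9 : n ^ 3 ≤ A ^ 3 * (8 * (Finset.univ.filter fun f : Fin 3 → V =>
        (∀ u, f u ∉ F) ∧ H ⟨⟨x, hx⟩, v, r⟩ f).card) := by
      calc n ^ 3 ≤ (A * d) ^ 3 := Nat.pow_le_pow_left hA 3
        _ = A ^ 3 * d ^ 3 := by ring
        _ ≤ _ := Nat.mul_le_mul_left _ h8
    have h10 : (n : ℝ) ^ 3 ≤ (A : ℝ) ^ 3 * (8 * ((Finset.univ.filter fun f : Fin 3 → V =>
        (∀ u, f u ∉ F) ∧ H ⟨⟨x, hx⟩, v, r⟩ f).card : ℝ)) := by exact_mod_cast h9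
    have hA3 : (0 : ℝ) < 8 * (A : ℝ) ^ 3 := by positivity
    rw [Fintype.card_fun, Fintype.card_fin, ← hn, one_div, inv_mul_le_iff₀ hA3]
    push_cast
    linarith
  have hcardK : (Fintype.card K : ℝ) ≤ 2 * (n : ℝ) ^ 2 := by
    have : Fintype.card K ≤ n * (n * 2) := by
      simp only [K, Fintype.card_prod, Fintype.card_bool]
      exact Nat.mul_le_mul_right _ (Fintype.card_subtype_le _)
    have : (Fintype.card K : ℝ) ≤ n * (n * 2) := by exact_mod_cast this
    nlinarith
  obtain ⟨L, l1, l2, l3⟩ := exists_disjoint_tuples_quota H (fun k f h => h.1) m q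
    (1 / (8 * (A : ℝ) ^ 3)) (by positivity)
    (fun F hF k => by convert hcount F hF k) (by
      refine lt_of_le_of_lt ?_ hq
      have e : 1 - 1 / (8 * (A : ℝ) ^ 3) / 2 = 1 - 1 / (16 * (A : ℝ) ^ 3) := by
        rw [div_div]; ring_nf
      rw [e]
      refine mul_le_mul_of_nonneg_right hcardK (pow_nonneg ?_ _)
      have hA1 : (1 : ℝ) ≤ (A : ℝ) ^ 3 := one_le_pow₀ (by exact_mod_cast hA0)
      rw [sub_nonneg, div_le_one (by positivity)]
      linarith)
  refine ⟨L, l1, fun i => ?_, fun x hx r v => ?_⟩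
  · obtain ⟨k, hk⟩ := l2 i
    exact ⟨hk.2.1, hk.2.2.1⟩
  · refine (l3 ⟨⟨x, hx⟩, v, r⟩).trans (Finset.card_le_card fun i hi => ?_)
    simp only [Finset.mem_filter, Finset.mem_univ, true_and] at hi ⊢
    exact hi.2.2.2

/-- Two of the three places of an absorber, and the elements that they hold. -/
theorem IsRich.exists_gadget [Fintype V] [DecidableEq V] (hE : IsRich E d g) {c e K : ℕ}
    (h1 : 2 * ((2 * K + 1) * Fintype.card V) < d ^ 2) (h2 : 2 * (K + 4 + g) ≤ c)
    (h3 : 4 * (Fintype.card V * e) ≤ c * d) (h4 : 2 * (K + 4 + 2 * g) ≤ d) (h5 : 2 * g + 2 ≤ e)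
    {a b y : V} (hab : c ≤ (mid E s t a b).card) (hy : y ∉ bad E s t c d) (F : Finset V)
    (hF : F.card ≤ K) :
    ∃ f : Fin 6 → V, Function.Injective f ∧ (∀ u, f u ∉ F) ∧
      Fits E s t a (f 0) b ∧ Fits E s t (f 1) (f 0) (f 2) ∧ Fits E s t (f 1) (f 3) (f 2) ∧
      Fits E s t (f 4) (f 3) (f 5) ∧ Fits E s t (f 4) y (f 5) := by
  classical
  -- As `y` is not bad, there is a pair `(a₃, b₃)` around it with many middle vertices. It remains
  -- to link a middle vertex `x₁` of `(a, b)` to a middle vertex `x₂` of `(a₃, b₃)` by a pair `(a₂,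
  -- b₂)` around both.
  obtain ⟨⟨a₃, b₃⟩, hp⟩ : ((ends E s t c y).filter fun p =>
      p.1 ∉ F ∧ p.2 ∉ F ∧ p.1 ≠ p.2).Nonempty := by
    rw [← Finset.card_pos]
    have e1 := card_ends_avoiding hy F
    have e2 : (2 * F.card + 1) * Fintype.card V ≤ (2 * K + 1) * Fintype.card V :=
      Nat.mul_le_mul_right _ (by omega)
    omega
  simp only [ends, Finset.mem_filter, Finset.mem_univ, true_and] at hp
  obtain ⟨⟨p1, p2⟩, p3, p4, p5⟩ := hp
  set F₂ := F ∪ {a₃, b₃} with hF₂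
  have hF₂c : F₂.card ≤ K + 2 := (Finset.card_union_le _ _).trans
    (Nat.add_le_add hF Finset.card_le_two)
  set X₂ := mid E s t a₃ b₃ \ F₂ with hX₂
  set X₁ := mid E s t a b \ F₂ with hX₁
  have hX₂c : c ≤ 2 * X₂.card := by
    have := Finset.le_card_sdiff F₂ (mid E s t a₃ b₃)
    rw [hX₂]
    omega
  have hX₁c : g ≤ X₁.card := by
    have := Finset.le_card_sdiff F₂ (mid E s t a b)
    rw [hX₁]
    omega
  -- Candidates for `b₂`, having at least `e` neighbours in `X₂`. The edges of direction `t` leaving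
  -- `X₂`, at least `|X₂| * d` in number, show that there are at least `2 * g` candidates. An edge
  -- from `X₁` to `B₂` then fixes `x₁` and `b₂`, and an edge between the neighbourhoods of these two
  -- fixes `a₂` and `x₂`.
  set B₂ := Finset.univ.filter fun b => b ∉ F₂ ∧ e ≤ (nbr (E (!t)) b ∩ X₂).card with hB₂
  have hB₂c : 2 * g ≤ B₂.card := by
    have e1 : X₂.card * d ≤ ∑ b, (nbr (E (!t)) b ∩ X₂).card := by
      calc X₂.card * d ≤ ∑ x ∈ X₂, (nbr (E t) x).card := by
            rw [← smul_eq_mul]; exact Finset.card_nsmul_le_sum _ _ _ fun x _ => hE.le_degree t x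
        _ = ∑ b, (nbr (E (!t)) b ∩ X₂).card := by
            have : ∑ x ∈ X₂, (nbr (E t) x).card = ∑ b, (X₂.filter fun x => E t x b).card := by
              simp only [nbr, Finset.card_filter]
              exact Finset.sum_comm
            refine this.trans (Finset.sum_congr rfl fun b _ => congrArg Finset.card ?_)
            ext x
            simp only [Finset.mem_inter, mem_nbr, Finset.mem_filter]
            symm
            exact ⟨fun h => ⟨h.2, hE.symm' h.1⟩, fun h => ⟨hE.symm h.2, h.1⟩⟩
    have e2 : ∑ b, (nbr (E (!t)) b ∩ X₂).card ≤
        (B₂.card + F₂.card) * X₂.card + Fintype.card V * e := by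
      calc ∑ b, (nbr (E (!t)) b ∩ X₂).card
          ≤ ∑ b, ((if b ∈ B₂ ∪ F₂ then X₂.card else 0) + e) := by
            refine Finset.sum_le_sum fun b _ => ?_
            split_ifs with hb
            · exact (Finset.card_le_card Finset.inter_subset_right).trans (Nat.le_add_right _ _)
            · simp only [hB₂, Finset.mem_union, Finset.mem_filter, Finset.mem_univ, true_and,
                not_or, not_and, not_le] at hb
              have := hb.1 hb.2
              omega
        _ = (B₂ ∪ F₂).card * X₂.card + Fintype.card V * e := by
            rw [Finset.sum_add_distrib, Finset.sum_ite_mem, Finset.univ_inter, Finset.sum_const,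
              Finset.sum_const, smul_eq_mul, smul_eq_mul, Finset.card_univ]
        _ ≤ _ := Nat.add_le_add_right
            (Nat.mul_le_mul_right _ (Finset.card_union_le _ _)) _
    by_contra hlt
    push Not at hlt
    have e3 : (B₂.card + F₂.card + 1) * 2 ≤ d := by omega
    have hX0 : 0 < X₂.card := by
      have := hE.pos
      omega
    have e4 : 2 * (X₂.card * d) ≤ X₂.card * ((B₂.card + F₂.card) * 2) + 2 * (Fintype.card V * e) := by
      nlinarith
    have e5 : X₂.card * ((B₂.card + F₂.card + 1) * 2) ≤ X₂.card * d := Nat.mul_le_mul_left _ e3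
    have e6 : c * d ≤ 2 * X₂.card * d := Nat.mul_le_mul_right _ hX₂c
    nlinarith
  obtain ⟨x₁, hx₁, b₂, hb₂, hne, hedge⟩ := hE.exists_edge_of_two_mul_le t X₁ B₂ hX₁c hB₂c
  simp only [hX₁, hB₂, hF₂, Finset.mem_sdiff, mem_mid, Finset.mem_filter, Finset.mem_univ,
    true_and, Finset.mem_union, Finset.mem_insert, Finset.mem_singleton, not_or] at hx₁ hb₂
  obtain ⟨q1, q2, q3, q4⟩ := hx₁
  obtain ⟨⟨r1, r2, r3⟩, r4⟩ := hb₂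
  obtain ⟨a₂, ha₂, x₂, hx₂, hne', hedge'⟩ := hE.exists_edge_of_two_mul_le s
    (nbr (E (!s)) x₁ \ (F₂ ∪ {x₁, b₂})) ((nbr (E (!t)) b₂ ∩ X₂) \ {x₁, b₂}) (by
      have e1 := card_sdiff_nbr hE (!s) x₁ (F₂ ∪ {x₁, b₂})
      have e2 := Finset.card_union_le F₂ {x₁, b₂}
      have e3 := Finset.card_le_two (a := x₁) (b := b₂)
      omega) (by
      have e1 := Finset.le_card_sdiff {x₁, b₂} (nbr (E (!t)) b₂ ∩ X₂)
      have e3 := Finset.card_le_two (a := x₁) (b := b₂)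
      omega)
  simp only [hX₂, hF₂, Finset.mem_sdiff, mem_mid, Finset.mem_inter, mem_nbr,
    Finset.mem_union, Finset.mem_insert, Finset.mem_singleton, not_or] at ha₂ hx₂
  obtain ⟨v1, ⟨v2, v3, v4⟩, v5, v6⟩ := ha₂
  obtain ⟨⟨w1, w2, w3, w4, w5⟩, w6, w7⟩ := hx₂
  refine ⟨![x₁, a₂, b₂, x₂, a₃, b₃], ?_, ?_, q1, ⟨hE.symm' v1, hedge⟩, ⟨hedge', hE.symm' w1⟩, w2,
    p1⟩
  · rw [← List.nodup_ofFn]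
    simp only [List.ofFn_succ, List.ofFn_zero, Matrix.cons_val_zero, Matrix.cons_val_succ,
      List.nodup_cons, List.mem_cons, List.not_mem_nil, not_or, List.nodup_nil, not_false_eq_true,
      and_true]
    exact ⟨⟨Ne.symm v5, hne, Ne.symm w6, q3, q4⟩, ⟨v6, hne', v3, v4⟩, ⟨Ne.symm w7, r2, r3⟩, ⟨w4, w5⟩, p5⟩
  · intro u
    fin_cases u <;> assumption

/-- The position of the vertices of an absorber in the two families they are chosen in. -/
def absorberIndex : Fin 3 × Fin 3 → Fin 3 ⊕ Fin 6 := fun p =>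
  (![![.inl 0, .inr 0, .inl 1], ![.inr 1, .inr 3, .inr 2], ![.inr 4, .inl 2, .inr 5]] :
    Fin 3 → Fin 3 → Fin 3 ⊕ Fin 6) p.1 p.2

theorem absorberIndex_injective : Function.Injective absorberIndex := by decide

/-- An absorber consists of three triples. Their middle vertices can be replaced by a new one and
the first two of the old ones. -/
structure IsAbsorber (E : Bool → V → V → Prop) (s t : Bool) (A : Fin 3 → Fin 3 → V) : Prop where
  fits : ∀ v, Fits E s t (A v 0) (A v 1) (A v 2)
  fits₁ : Fits E s t (A 1 0) (A 0 1) (A 1 2)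
  fits₂ : Fits E s t (A 2 0) (A 1 1) (A 2 2)

-- Each spread triple is completed by a gadget, disjointly from all others. Only the triple enters
-- the quota, so completing it preserves the count. Here `9 * m` bounds the vertices to be avoided:
-- three from the triple and six from the gadget of each absorber.
open Classical in
theorem IsRich.exists_absorbers [Fintype V] [Nonempty V] [DecidableEq V] (hE : IsRich E d g)
    {c m q A e : ℕ} (hA : Fintype.card V ≤ A * d) (hd : 0 < d)
    (h1 : (36 * m + 4) * Fintype.card V < d ^ 2)
    (h2 : 2 * ((bad E s t c d).card + 9 * m + 4 + 2 * g) ≤ d)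
    (hq : 2 * (Fintype.card V : ℝ) ^ 2 * (1 - 1 / (16 * (A : ℝ) ^ 3)) ^ m < (1 / 2 : ℝ) ^ q)
    (h3 : 2 * (9 * m + 4 + g) ≤ c) (h4 : 4 * (Fintype.card V * e) ≤ c * d) (h5 : 2 * g + 2 ≤ e) :
    ∃ L : Fin m → Fin 3 → Fin 3 → V,
      Function.Injective (fun p : Fin m × Fin 3 × Fin 3 => L p.1 p.2.1 p.2.2) ∧
      (∀ i, IsAbsorber E s t (L i)) ∧
      ∀ x ∉ bad E s t c d, ∀ r v, q ≤ (Finset.univ.filter fun i =>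
        Fits E s t (L i 0 0) x (L i 0 2) ∧ E r v (L i 2 1)).card := by
  obtain ⟨T, t1, t2, t3⟩ := hE.exists_spread_triples (s := s) (t := t) (c := c) (m := m) (q := q)
    hA hd (by nlinarith) (by omega) hq
  obtain ⟨G, g1, g2, g3⟩ := exists_disjoint_tuples (ι := Fin m) (κ := Fin 6)
    (fun i f => Fits E s t (T i 0) (f 0) (T i 1) ∧ Fits E s t (f 1) (f 0) (f 2) ∧
      Fits E s t (f 1) (f 3) (f 2) ∧ Fits E s t (f 4) (f 3) (f 5) ∧ Fits E s t (f 4) (T i 2) (f 5))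
    (Finset.univ.image fun p : Fin m × Fin 3 => T p.1 p.2) (by
      intro i F hF
      have hF' : F.card ≤ 9 * m := by
        have : (Finset.univ.image fun p : Fin m × Fin 3 => T p.1 p.2).card ≤ m * 3 := by
          refine Finset.card_image_le.trans ?_
          simp
        simp only [Fintype.card_fin] at hF
        omega
      exact hE.exists_gadget (K := 9 * m) (by nlinarith) (by omega) h4 (by omega) h5
        (t2 i).1 (t2 i).2 F hF')
  have hTG : ∀ i u j w, G i u ≠ T j w := fun i u j w h => g2 i u
    (Finset.mem_image.2 ⟨(j, w), Finset.mem_univ _, h.symm⟩)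
  refine ⟨fun i v u => Sum.elim (T i) (G i) (absorberIndex (v, u)), ?_, ?_, ?_⟩
  · rintro ⟨i, v, u⟩ ⟨j, v', u'⟩ h
    simp only at h
    suffices i = j ∧ absorberIndex (v, u) = absorberIndex (v', u') by
      have h' := absorberIndex_injective this.2
      simp only [Prod.mk.injEq] at h' ⊢
      exact ⟨this.1, h'⟩
    rcases hx : absorberIndex (v, u) with x | x <;> rcases hy : absorberIndex (v', u') with y | y <;>
      rw [hx, hy] at h <;> simp only [Sum.elim_inl, Sum.elim_inr] at h
    · have := t1 (a₁ := (i, x)) (a₂ := (j, y)) h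
      simp only [Prod.mk.injEq] at this
      exact ⟨this.1, by rw [this.2]⟩
    · exact (hTG _ _ _ _ h.symm).elim
    · exact (hTG _ _ _ _ h).elim
    · have := g1 (a₁ := (i, x)) (a₂ := (j, y)) h
      simp only [Prod.mk.injEq] at this
      exact ⟨this.1, by rw [this.2]⟩
  · intro i
    obtain ⟨k1, k2, k3, k4, k5⟩ := g3 i
    refine ⟨fun v => ?_, k2, k4⟩
    fin_cases v
    · exact k1
    · exact k3
    · exact k5
  · exact t3

/-! ### Absorbing paths built from blocks of five vertices. -/

/-- The first `h` values of `q` form a path with the directions `τ`, and the triples of `m`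
absorbers with directions `s` and `t` start at the positions `P i v` of this path. -/
structure IsAbsorbingPath (E : Bool → V → V → Prop) (τ : ℕ → Bool) (s t : Bool) (h : ℕ) {m : ℕ}
    (q : ℕ → V) (P : Fin m → Fin 3 → ℕ) : Prop where
  injOn : ∀ i < h, ∀ j < h, q i = q j → i = j
  edge : ∀ i, i + 1 < h → E (τ i) (q i) (q (i + 1))
  inj : ∀ i v j w, P i v = P j w → i = j ∧ v = w
  lt : ∀ i v, P i v + 2 < h
  mod : ∀ i v, P i v % 5 = 0
  dir : ∀ i v, τ (P i v) = s ∧ τ (P i v + 1) = t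
  fits₁ : ∀ i, Fits E s t (q (P i 1)) (q (P i 0 + 1)) (q (P i 1 + 2))
  fits₂ : ∀ i, Fits E s t (q (P i 2)) (q (P i 1 + 1)) (q (P i 2 + 2))

/-- Reserves `m * 3` blocks with suitable directions for the absorbers and numbers the remaining
ones. -/
theorem exists_block_equiv {J m : ℕ} (p : Fin J → Prop) [DecidablePred p]
    (h : m * 3 ≤ (Finset.univ.filter p).card) :
    ∃ e : Fin J ≃ (Fin m × Fin 3) ⊕ Fin (J - m * 3), ∀ x, p (e.symm (Sum.inl x)) := by
  obtain ⟨T, hT, hc⟩ := Finset.exists_subset_card_eq h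
  have e₁ : {j // j ∈ T} ≃ Fin m × Fin 3 := Fintype.equivOfCardEq (by simp [hc])
  have e₂ : {j // ¬ j ∈ T} ≃ Fin (J - m * 3) := Fintype.equivOfCardEq (by
    rw [Fintype.card_subtype_compl]; simp [hc])
  refine ⟨(Equiv.sumCompl (· ∈ T)).symm.trans (e₁.sumCongr e₂), fun x => ?_⟩
  have := hT (e₁.symm x).2
  simpa using this

/-- The triples of `J` blocks, among them those of given absorbers; they contain the set `X`. -/
theorem IsRich.exists_block_triples [Fintype V] [DecidableEq V] [Nonempty V] (hE : IsRich E d g)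
    {m J : ℕ} (τ : ℕ → Bool) (L : Fin m → Fin 3 → Fin 3 → V)
    (hL : Function.Injective (fun p : Fin m × Fin 3 × Fin 3 => L p.1 p.2.1 p.2.2))
    (hLa : ∀ i, IsAbsorber E s t (L i))
    (hτ : m * 3 ≤ (Finset.univ.filter fun j : Fin J => τ (5 * j) = s ∧ τ (5 * j + 1) = t).card)
    (X : Finset V) (hJ : X.card + m * 3 ≤ J) (hd : 9 * m + 5 * J + 2 ≤ d) :
    ∃ (Θ : Fin J → Fin 3 → V) (B : Fin m × Fin 3 → Fin J),
      (∀ j u j' u', Θ j u = Θ j' u' → j = j' ∧ u = u') ∧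
      (∀ j : Fin J, Fits E (τ (5 * j)) (τ (5 * j + 1)) (Θ j 0) (Θ j 1) (Θ j 2)) ∧
      Function.Injective B ∧ (∀ p, τ (5 * B p) = s ∧ τ (5 * B p + 1) = t) ∧
      (∀ p u, Θ (B p) u = L p.1 p.2 u) ∧ ∀ x ∈ X, ∃ j u, Θ j u = x := by
  obtain ⟨v₀⟩ := ‹Nonempty V›
  have hdn : d ≤ Fintype.card V := (hE.le_degree s v₀).trans (Finset.card_le_univ _)
  obtain ⟨e, he⟩ := exists_block_equiv (fun j : Fin J => τ (5 * j) = s ∧ τ (5 * j + 1) = t) hτ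
  -- the middle vertices of the other blocks
  set U := Finset.univ.image (fun p : Fin m × Fin 3 × Fin 3 => L p.1 p.2.1 p.2.2) with hU
  have hUc : U.card ≤ 9 * m := by
    refine Finset.card_image_le.trans ?_
    simp only [Finset.card_univ, Fintype.card_prod, Fintype.card_fin]
    omega
  -- The vertices of `X` outside the absorbers become middle vertices of spare blocks; `W` is padded
  -- so that each spare block receives exactly one.
  obtain ⟨W, hW1, hW2, hWc⟩ := Finset.exists_subsuperset_card_eq
    (s := X \ U) (t := Finset.univ \ U) (n := J - m * 3)
    (Finset.sdiff_subset_sdiff (Finset.subset_univ _) le_rfl)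
    ((Finset.card_le_card Finset.sdiff_subset).trans (by omega)) (by
      have := Finset.le_card_sdiff U Finset.univ
      rw [Finset.card_univ] at this
      omega)
  let w : Fin (J - m * 3) → V := fun ρ => ((Finset.equivFinOfCardEq hWc).symm ρ : V)
  have hw : Function.Injective w := Subtype.val_injective.comp (Equiv.injective _)
  have hwW : ∀ ρ, w ρ ∈ W := fun ρ => Subtype.prop _
  have hWw : ∀ x ∈ W, ∃ ρ, w ρ = x := fun x hx =>
    ⟨Finset.equivFinOfCardEq hWc ⟨x, hx⟩, by simp [w]⟩
  obtain ⟨R, r1, r2, r3⟩ := exists_disjoint_tuples (ι := Fin (J - m * 3)) (κ := Fin 2)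
    (fun ρ f => Fits E (τ (5 * (e.symm (Sum.inr ρ) : Fin J)))
      (τ (5 * (e.symm (Sum.inr ρ) : Fin J) + 1)) (f 0) (w ρ) (f 1)) (U ∪ W) (by
      intro ρ F hF
      have h1 := Finset.card_union_le U W
      simp only [Fintype.card_fin] at hF
      obtain ⟨a, ha, ha'⟩ := hE.exists_nbr (!τ (5 * (e.symm (Sum.inr ρ) : Fin J))) (w ρ) F
        (by omega)
      obtain ⟨b, hb, hb'⟩ := hE.exists_nbr (τ (5 * (e.symm (Sum.inr ρ) : Fin J) + 1)) (w ρ)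
        (insert a F) (by
          have := Finset.card_insert_le a F
          omega)
      simp only [Finset.mem_insert, not_or] at hb
      refine ⟨![a, b], ?_, ?_, hE.symm' ha', hb'⟩
      · intro i i' hij
        fin_cases i <;> fin_cases i' <;>
          first | rfl | exact (hb.1 hij.symm).elim | exact (hb.1 hij).elim
      · intro u
        fin_cases u
        · exact ha
        · exact hb.2)
  have r2' : ∀ ρ u, R ρ u ∉ U ∧ R ρ u ∉ W := fun ρ u => by simpa using r2 ρ u
  have hwU : ∀ ρ, w ρ ∉ U := fun ρ => (Finset.mem_sdiff.1 (hW2 (hwW ρ))).2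
  have hLU : ∀ i v u, L i v u ∈ U := fun i v u =>
    Finset.mem_image.2 ⟨(i, v, u), Finset.mem_univ _, rfl⟩
  let R₃ : Fin (J - m * 3) → Fin 3 → V := fun ρ => ![R ρ 0, w ρ, R ρ 1]
  have hR₃U : ∀ ρ u, R₃ ρ u ∉ U := by
    intro ρ u
    fin_cases u
    · exact (r2' ρ 0).1
    · exact hwU ρ
    · exact (r2' ρ 1).1
  have hRw : ∀ ρ u ρ', R ρ u ≠ w ρ' := fun ρ u ρ' h => (r2' ρ u).2 (h ▸ hwW ρ')
  have r1' : ∀ ρ u ρ' u', R ρ u = R ρ' u' → ρ = ρ' ∧ u = u' := fun ρ u ρ' u' h => by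
    simpa using r1 (a₁ := (ρ, u)) (a₂ := (ρ', u')) h
  have hR₃ : ∀ ρ u ρ' u', R₃ ρ u = R₃ ρ' u' → ρ = ρ' ∧ u = u' := by
    intro ρ u ρ' u' h
    fin_cases u <;> fin_cases u' <;>
      simp only [Fin.zero_eta, Fin.mk_one, Fin.reduceFinMk, Matrix.cons_val_zero, Matrix.cons_val_one,
        Matrix.cons_val, R₃] at h
    · exact ⟨(r1' _ _ _ _ h).1, rfl⟩
    · exact (hRw _ _ _ h).elim
    · simpa using (r1' _ _ _ _ h).2
    · exact (hRw _ _ _ h.symm).elim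
    · exact ⟨hw h, rfl⟩
    · exact (hRw _ _ _ h.symm).elim
    · simpa using (r1' _ _ _ _ h).2
    · exact (hRw _ _ _ h).elim
    · exact ⟨(r1' _ _ _ _ h).1, rfl⟩
  -- the triples of all blocks
  let Θ : Fin J → Fin 3 → V := fun j => Sum.elim (fun p : Fin m × Fin 3 => L p.1 p.2) R₃ (e j)
  have hΘl : ∀ p u, Θ (e.symm (Sum.inl p)) u = L p.1 p.2 u := fun p u => by simp [Θ]
  have hΘr : ∀ ρ u, Θ (e.symm (Sum.inr ρ)) u = R₃ ρ u := fun ρ u => by simp [Θ]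
  have hΘ : ∀ j u j' u', Θ j u = Θ j' u' → j = j' ∧ u = u' := by
    intro j u j' u' h
    obtain ⟨x, rfl⟩ := e.symm.surjective j
    obtain ⟨x', rfl⟩ := e.symm.surjective j'
    rcases x with ⟨i, v⟩ | ρ <;> rcases x' with ⟨i', v'⟩ | ρ' <;> simp only [hΘl, hΘr] at h
    · have := hL (a₁ := (i, v, u)) (a₂ := (i', v', u')) h
      simp only [Prod.mk.injEq] at this
      simp [this]
    · exact (hR₃U _ _ (h ▸ hLU _ _ _)).elim
    · exact (hR₃U _ _ (h ▸ hLU _ _ _)).elim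
    · have := hR₃ _ _ _ _ h
      simp [this]
  have hΘf : ∀ j : Fin J, Fits E (τ (5 * j)) (τ (5 * j + 1)) (Θ j 0) (Θ j 1) (Θ j 2) := by
    intro j
    obtain ⟨x, rfl⟩ := e.symm.surjective j
    rcases x with p | ρ
    · simp only [hΘl]
      rw [(he p).1, (he p).2]
      exact (hLa p.1).fits p.2
    · simp only [hΘr]
      exact r3 ρ
  refine ⟨Θ, fun p => e.symm (Sum.inl p), hΘ, hΘf, e.symm.injective.comp Sum.inl_injective, he, hΘl,
    fun x hx => ?_⟩
  by_cases hxU : x ∈ U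
  · obtain ⟨⟨i, v, u⟩, -, rfl⟩ := Finset.mem_image.1 hxU
    exact ⟨_, u, hΘl (i, v) u⟩
  · obtain ⟨ρ, rfl⟩ := hWw x (hW1 (Finset.mem_sdiff.2 ⟨hx, hxU⟩))
    exact ⟨_, 1, hΘr ρ 1⟩

/-- Consecutive triples are joined by two further vertices each. -/
theorem IsRich.exists_block_path [Fintype V] [DecidableEq V] [Nonempty V] (hE : IsRich E d g)
    {J : ℕ} (τ : ℕ → Bool) (Θ : Fin J → Fin 3 → V)
    (hΘ : ∀ j u j' u', Θ j u = Θ j' u' → j = j' ∧ u = u')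
    (hΘf : ∀ j : Fin J, Fits E (τ (5 * j)) (τ (5 * j + 1)) (Θ j 0) (Θ j 1) (Θ j 2))
    (hd : 5 * J + 2 * g ≤ d) :
    ∃ q : ℕ → V, (∀ i < 5 * J, ∀ j < 5 * J, q i = q j → i = j) ∧
      (∀ i, i + 1 < 5 * J → E (τ i) (q i) (q (i + 1))) ∧
      ∀ (j : Fin J) (u : Fin 3), q (5 * j + u) = Θ j u := by
  obtain ⟨v₀⟩ := ‹Nonempty V›
  -- The last block has no successor; the edge from its final connecting vertex to the default `v₀`
  -- is never used.
  let next : Fin J → V := fun j => if h : j.1 + 1 < J then Θ ⟨j + 1, h⟩ 0 else v₀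
  obtain ⟨C, c1, c2, c3⟩ := exists_disjoint_tuples (ι := Fin J) (κ := Fin 2)
    (fun j f => E (τ (5 * j + 2)) (Θ j 2) (f 0) ∧ E (τ (5 * j + 3)) (f 0) (f 1) ∧
      E (τ (5 * j + 4)) (f 1) (next j))
    (Finset.univ.image fun p : Fin J × Fin 3 => Θ p.1 p.2) (by
      intro j F hF
      have h1 : (Finset.univ.image fun p : Fin J × Fin 3 => Θ p.1 p.2).card ≤ J * 3 := by
        refine Finset.card_image_le.trans ?_
        simp
      simp only [Fintype.card_fin] at hF
      obtain ⟨x, y, hxy, hx, hy, e1, e2, e3⟩ := hE.exists_connection (τ (5 * j + 2))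
        (τ (5 * j + 3)) (τ (5 * j + 4)) (Θ j 2) (next j) F (by omega)
      refine ⟨![x, y], ?_, ?_, e1, e2, e3⟩
      · intro i i' hij
        fin_cases i <;> fin_cases i' <;> first | rfl | exact (hxy hij).elim | exact (hxy hij.symm).elim
      · intro u
        fin_cases u
        · exact hx
        · exact hy)
  have hCΘ : ∀ j u j' u', C j u ≠ Θ j' u' := fun j u j' u' h => c2 j u
    (Finset.mem_image.2 ⟨(j', u'), Finset.mem_univ _, h.symm⟩)
  let Ψ : Fin J → Fin 5 → V := fun j u =>
    Sum.elim (Θ j) (C j) ((finSumFinEquiv (m := 3) (n := 2)).symm u)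
  have hΨ : ∀ j u j' u', Ψ j u = Ψ j' u' → j = j' ∧ u = u' := by
    intro j u j' u' h
    obtain ⟨x, rfl⟩ := (finSumFinEquiv (m := 3) (n := 2)).surjective u
    obtain ⟨x', rfl⟩ := (finSumFinEquiv (m := 3) (n := 2)).surjective u'
    simp only [Ψ, Equiv.symm_apply_apply] at h
    rcases x with x | x <;> rcases x' with x' | x' <;> simp only [Sum.elim_inl, Sum.elim_inr] at h
    · have := hΘ _ _ _ _ h
      exact ⟨this.1, by rw [this.2]⟩
    · exact (hCΘ _ _ _ _ h.symm).elim
    · exact (hCΘ _ _ _ _ h).elim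
    · have := c1 (a₁ := (j, x)) (a₂ := (j', x')) h
      simp only [Prod.mk.injEq] at this
      exact ⟨this.1, by rw [this.2]⟩
  let q : ℕ → V := fun i => if h : i < 5 * J then Ψ ⟨i / 5, by omega⟩ ⟨i % 5, by omega⟩ else v₀
  have hq : ∀ (j : Fin J) (u : Fin 5), q (5 * j + u) = Ψ j u := by
    intro j u
    have h1 := j.2
    have h2 := u.2
    have h : 5 * j.1 + u.1 < 5 * J := by omega
    simp only [q, dif_pos h]
    congr 1
    · ext; simp; omega
    · ext; simp
  have hq0 : ∀ j : Fin J, q (5 * j) = Θ j 0 := fun j => hq j 0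
  have hq1 : ∀ j : Fin J, q (5 * j + 1) = Θ j 1 := fun j => hq j 1
  have hq2 : ∀ j : Fin J, q (5 * j + 2) = Θ j 2 := fun j => hq j 2
  have hq3 : ∀ j : Fin J, q (5 * j + 3) = C j 0 := fun j => hq j 3
  have hq4 : ∀ j : Fin J, q (5 * j + 4) = C j 1 := fun j => hq j 4
  refine ⟨q, ?_, ?_, fun j u => hq j (Fin.castAdd 2 u) |>.trans ?_⟩
  · intro i hi j hj h
    simp only [q, dif_pos hi, dif_pos hj] at h
    have := hΨ _ _ _ _ h
    simp only [Fin.mk.injEq] at this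
    omega
  · intro i hi
    obtain ⟨j, u, hj, hu, rfl⟩ : ∃ j u, j < J ∧ u < 5 ∧ i = 5 * j + u :=
      ⟨i / 5, i % 5, by omega, by omega, by omega⟩
    have hf := hΘf ⟨j, hj⟩
    have hc := c3 ⟨j, hj⟩
    have h0 := hq0 ⟨j, hj⟩
    have h1 := hq1 ⟨j, hj⟩
    have h2 := hq2 ⟨j, hj⟩
    have h3 := hq3 ⟨j, hj⟩
    have h4 := hq4 ⟨j, hj⟩
    simp only at h0 h1 h2 h3 h4 hf hc
    interval_cases u
    · simp only [add_zero]
      rw [h0, h1]; exact hf.1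
    · rw [h1, h2]; exact hf.2
    · rw [h2, h3]; exact hc.1
    · rw [h3, h4]; exact hc.2.1
    · have h5 : j + 1 < J := by omega
      rw [h4, show 5 * j + 4 + 1 = 5 * (⟨j + 1, h5⟩ : Fin J).1 by simp; ring, hq0]
      have := hc.2.2
      simpa only [next, dif_pos h5] using this
  · simp [Ψ, ← finSumFinEquiv_apply_left]

open Classical in
/-- A path that contains given absorbers and all bad vertices. -/
theorem IsRich.exists_absorbingPath [Fintype V] [DecidableEq V] [Nonempty V] (hE : IsRich E d g)
    {c m J q₀ : ℕ} (τ : ℕ → Bool) (L : Fin m → Fin 3 → Fin 3 → V)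
    (hL : Function.Injective (fun p : Fin m × Fin 3 × Fin 3 => L p.1 p.2.1 p.2.2))
    (hLa : ∀ i, IsAbsorber E s t (L i))
    (hLq : ∀ x ∉ bad E s t c d, ∀ r v, q₀ ≤ (Finset.univ.filter fun i =>
        Fits E s t (L i 0 0) x (L i 0 2) ∧ E r v (L i 2 1)).card)
    (hτ : m * 3 ≤ (Finset.univ.filter fun j : Fin J => τ (5 * j) = s ∧ τ (5 * j + 1) = t).card)
    (hJ : (bad E s t c d).card + m * 3 ≤ J) (hd : 9 * m + 5 * J + 2 * g + 2 ≤ d) :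
    ∃ (q : ℕ → V) (P : Fin m → Fin 3 → ℕ), IsAbsorbingPath E τ s t (5 * J) q P ∧
      (∀ x ∈ bad E s t c d, ∃ i < 5 * J, q i = x) ∧
      ∀ x ∉ bad E s t c d, ∀ r v, q₀ ≤ (Finset.univ.filter fun i =>
        Fits E s t (q (P i 0)) x (q (P i 0 + 2)) ∧ E r v (q (P i 2 + 1))).card := by
  obtain ⟨Θ, B, hΘ, hΘf, hB, hBτ, hΘL, hX⟩ := hE.exists_block_triples τ L hL hLa hτ
    (bad E s t c d) hJ (by omega)
  obtain ⟨q, hqi, hqe, hq⟩ := hE.exists_block_path τ Θ hΘ hΘf (by omega)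
  have hq0 : ∀ j : Fin J, q (5 * j) = Θ j 0 := fun j => hq j 0
  have hq1 : ∀ j : Fin J, q (5 * j + 1) = Θ j 1 := fun j => hq j 1
  have hq2 : ∀ j : Fin J, q (5 * j + 2) = Θ j 2 := fun j => hq j 2
  refine ⟨q, fun i v => 5 * (B (i, v) : ℕ), ⟨hqi, hqe, ?_, ?_, ?_, ?_, ?_, ?_⟩, ?_, ?_⟩
  · intro i v j w h
    have : B (i, v) = B (j, w) := by
      ext
      simpa using h
    simpa using hB this
  · intro i v
    have := (B (i, v)).2
    show 5 * (B (i, v) : ℕ) + 2 < _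
    omega
  · intro i v
    simp
  · intro i v
    exact hBτ (i, v)
  · intro i
    rw [hq0, hq1, hq2, hΘL, hΘL, hΘL]
    exact (hLa i).fits₁
  · intro i
    rw [hq0, hq1, hq2, hΘL, hΘL, hΘL]
    exact (hLa i).fits₂
  · intro x hx
    obtain ⟨j, u, rfl⟩ := hX x hx
    refine ⟨5 * j + u, ?_, hq j u⟩
    have h1 := j.2
    have h2 := u.2
    omega
  · intro x hx r v
    simp only [hq0, hq1, hq2, hΘL]
    exact hLq x hx r v

/-! ### Absorbing leftover vertices and closing the cycle. -/

/-- Absorbing the vertices `x i` and releasing the last middle vertices of the absorbers in `I`. -/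
theorem IsAbsorbingPath.exists_swap {τ : ℕ → Bool} {h m : ℕ} {q : ℕ → V} {P : Fin m → Fin 3 → ℕ}
    (hq : IsAbsorbingPath E τ s t h q P) (I : Finset (Fin m)) (x : Fin m → V)
    (hx : ∀ i ∈ I, ∀ j ∈ I, x i = x j → i = j) (hxq : ∀ i ∈ I, ∀ j < h, x i ≠ q j)
    (hf : ∀ i ∈ I, Fits E s t (q (P i 0)) (x i) (q (P i 0 + 2))) :
    ∃ q' : ℕ → V, (∀ i < h, ∀ j < h, q' i = q' j → i = j) ∧
      (∀ i, i + 1 < h → E (τ i) (q' i) (q' (i + 1))) ∧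
      (∀ j, j % 5 ≠ 1 → q' j = q j) ∧
      ∀ j < h, (∃ i ∈ I, q' j = x i) ∨ ∃ j' < h, q' j = q j' ∧ ∀ i ∈ I, j' ≠ P i 2 + 1 := by
  classical
  -- `κ j` tells which triple of an active absorber, if any, has its middle vertex at position `j`.
  let κ : ℕ → Option (Fin m × Fin 3) := fun j =>
    if h : ∃ p : Fin m × Fin 3, p.1 ∈ I ∧ j = P p.1 p.2 + 1 then some h.choose else none
  have κ1 : ∀ i ∈ I, ∀ v, κ (P i v + 1) = some (i, v) := by
    intro i hi v
    have hex : ∃ p : Fin m × Fin 3, p.1 ∈ I ∧ P i v + 1 = P p.1 p.2 + 1 := ⟨(i, v), hi, rfl⟩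
    simp only [κ, dif_pos hex, Option.some.injEq]
    have h1 := hq.inj i v hex.choose.1 hex.choose.2 (by have := hex.choose_spec.2; omega)
    exact Prod.ext h1.1.symm h1.2.symm
  have κ2 : ∀ j i v, κ j = some (i, v) → i ∈ I ∧ j = P i v + 1 := by
    intro j i v hj
    simp only [κ] at hj
    split_ifs at hj with hex
    have h1 := hex.choose_spec
    rw [Option.some.inj hj] at h1
    exact h1
  have κ3 : ∀ j, κ j = none → ∀ i ∈ I, ∀ v, j ≠ P i v + 1 := by
    rintro _ hj i hi v rfl
    rw [κ1 i hi v] at hj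
    cases hj
  -- `c j` is the source of the new vertex at position `j`: an old position, or an absorbed vertex.
  -- Middle vertices shift by one triple within each active absorber.
  let c : ℕ → ℕ ⊕ Fin m := fun j => match κ j with
    | none => Sum.inl j
    | some (i, 0) => Sum.inr i
    | some (i, 1) => Sum.inl (P i 0 + 1)
    | some (i, 2) => Sum.inl (P i 1 + 1)
  have c0 : ∀ j, κ j = none → c j = Sum.inl j := fun j hj => by simp only [c, hj]
  have c1 : ∀ i ∈ I, c (P i 0 + 1) = Sum.inr i := fun i hi => by simp only [c, κ1 i hi]
  have c2 : ∀ i ∈ I, c (P i 1 + 1) = Sum.inl (P i 0 + 1) := fun i hi => by simp only [c, κ1 i hi]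
  have c3 : ∀ i ∈ I, c (P i 2 + 1) = Sum.inl (P i 1 + 1) := fun i hi => by simp only [c, κ1 i hi]
  have hcases : ∀ j, κ j = none ∨ (∃ i ∈ I, j = P i 0 + 1) ∨ (∃ i ∈ I, j = P i 1 + 1) ∨
      ∃ i ∈ I, j = P i 2 + 1 := by
    intro j
    rcases hj : κ j with _ | ⟨i, v⟩
    · exact Or.inl rfl
    · obtain ⟨hi, rfl⟩ := κ2 j i v hj
      right
      fin_cases v
      · exact Or.inl ⟨i, hi, rfl⟩
      · exact Or.inr (Or.inl ⟨i, hi, rfl⟩)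
      · exact Or.inr (Or.inr ⟨i, hi, rfl⟩)
  have cinj : Function.Injective c := by
    intro j j' hjj
    rcases hcases j with hj | ⟨i, hi, rfl⟩ | ⟨i, hi, rfl⟩ | ⟨i, hi, rfl⟩ <;>
      rcases hcases j' with hj' | ⟨i', hi', rfl⟩ | ⟨i', hi', rfl⟩ | ⟨i', hi', rfl⟩
    · rw [c0 _ hj, c0 _ hj'] at hjj; exact Sum.inl.inj hjj
    · rw [c0 _ hj, c1 _ hi'] at hjj; cases hjj
    · rw [c0 _ hj, c2 _ hi'] at hjj; exact (κ3 _ hj i' hi' 0 (Sum.inl.inj hjj)).elim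
    · rw [c0 _ hj, c3 _ hi'] at hjj; exact (κ3 _ hj i' hi' 1 (Sum.inl.inj hjj)).elim
    · rw [c1 _ hi, c0 _ hj'] at hjj; cases hjj
    · rw [c1 _ hi, c1 _ hi'] at hjj; rw [Sum.inr.inj hjj]
    · rw [c1 _ hi, c2 _ hi'] at hjj; cases hjj
    · rw [c1 _ hi, c3 _ hi'] at hjj; cases hjj
    · rw [c2 _ hi, c0 _ hj'] at hjj; exact (κ3 _ hj' i hi 0 (Sum.inl.inj hjj).symm).elim
    · rw [c2 _ hi, c1 _ hi'] at hjj; cases hjj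
    · rw [c2 _ hi, c2 _ hi'] at hjj
      rw [(hq.inj i 0 i' 0 (by have := Sum.inl.inj hjj; omega)).1]
    · rw [c2 _ hi, c3 _ hi'] at hjj
      exact absurd (hq.inj i 0 i' 1 (by have := Sum.inl.inj hjj; omega)).2 (by decide)
    · rw [c3 _ hi, c0 _ hj'] at hjj; exact (κ3 _ hj' i hi 1 (Sum.inl.inj hjj).symm).elim
    · rw [c3 _ hi, c1 _ hi'] at hjj; cases hjj
    · rw [c3 _ hi, c2 _ hi'] at hjj
      exact absurd (hq.inj i 1 i' 0 (by have := Sum.inl.inj hjj; omega)).2 (by decide)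
    · rw [c3 _ hi, c3 _ hi'] at hjj
      rw [(hq.inj i 1 i' 1 (by have := Sum.inl.inj hjj; omega)).1]
  have crange : ∀ j < h, (∃ i ∈ I, c j = Sum.inr i) ∨
      ∃ j' < h, c j = Sum.inl j' ∧ ∀ i ∈ I, j' ≠ P i 2 + 1 := by
    intro j hj
    rcases hcases j with hκ | ⟨i, hi, rfl⟩ | ⟨i, hi, rfl⟩ | ⟨i, hi, rfl⟩
    · exact Or.inr ⟨j, hj, c0 _ hκ, fun i hi => κ3 _ hκ i hi 2⟩
    · exact Or.inl ⟨i, hi, c1 i hi⟩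
    · refine Or.inr ⟨_, ?_, c2 i hi, fun i' _ e => ?_⟩
      · have := hq.lt i 0; omega
      · exact absurd (hq.inj i 0 i' 2 (by omega)).2 (by decide)
    · refine Or.inr ⟨_, ?_, c3 i hi, fun i' _ e => ?_⟩
      · have := hq.lt i 1; omega
      · exact absurd (hq.inj i 1 i' 2 (by omega)).2 (by decide)
  -- Only positions congruent to 1 modulo 5 change. No two of them are adjacent, so every affected
  -- edge lies within one triple and is covered by `Fits`.
  have hmod : ∀ j, j % 5 ≠ 1 → κ j = none := by
    intro j hj
    rcases hκ : κ j with _ | ⟨i, v⟩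
    · rfl
    · obtain ⟨-, rfl⟩ := κ2 j i v hκ
      have := hq.mod i v
      omega
  have hfits : ∀ i ∈ I, ∀ v, Fits E s t (q (P i v)) (Sum.elim q x (c (P i v + 1))) (q (P i v + 2)) := by
    intro i hi v
    fin_cases v
    · show Fits E s t (q (P i 0)) (Sum.elim q x (c (P i 0 + 1))) (q (P i 0 + 2))
      rw [c1 i hi]; exact hf i hi
    · show Fits E s t (q (P i 1)) (Sum.elim q x (c (P i 1 + 1))) (q (P i 1 + 2))
      rw [c2 i hi]; exact hq.fits₁ i
    · show Fits E s t (q (P i 2)) (Sum.elim q x (c (P i 2 + 1))) (q (P i 2 + 2))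
      rw [c3 i hi]; exact hq.fits₂ i
  refine ⟨fun j => Sum.elim q x (c j), ?_, ?_, ?_, ?_⟩
  · intro i hi j hj e
    apply cinj
    simp only at e
    rcases crange i hi with ⟨a, ha, e1⟩ | ⟨a, ha, e1, -⟩ <;>
      rcases crange j hj with ⟨b, hb, e2⟩ | ⟨b, hb, e2, -⟩ <;>
      rw [e1, e2] at e ⊢ <;> simp only [Sum.elim_inl, Sum.elim_inr] at e
    · rw [hx a ha b hb e]
    · exact (hxq a ha b hb e).elim
    · exact (hxq b hb a ha e.symm).elim
    · rw [hq.injOn a ha b hb e]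
  · intro i hi
    simp only
    by_cases h0 : i % 5 = 0
    · rw [c0 i (hmod i (by omega)), Sum.elim_inl]
      rcases hκ : κ (i + 1) with _ | ⟨a, v⟩
      · rw [c0 _ hκ]; exact hq.edge i hi
      · obtain ⟨ha, e⟩ := κ2 _ _ _ hκ
        obtain rfl : i = P a v := by omega
        rw [(hq.dir a v).1]
        exact (hfits a ha v).1
    · by_cases h1 : i % 5 = 1
      · rw [c0 (i + 1) (hmod (i + 1) (by omega)), Sum.elim_inl]
        rcases hκ : κ i with _ | ⟨a, v⟩
        · rw [c0 _ hκ]; exact hq.edge i hi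
        · obtain ⟨ha, rfl⟩ := κ2 _ _ _ hκ
          rw [(hq.dir a v).2]
          exact (hfits a ha v).2
      · rw [c0 i (hmod i h1), c0 (i + 1) (hmod (i + 1) (by omega))]
        exact hq.edge i hi
  · intro j hj
    simp only [c0 j (hmod j hj), Sum.elim_inl]
  · intro j hj
    rcases crange j hj with ⟨a, ha, e1⟩ | ⟨a, ha, e1, e2⟩
    · exact Or.inl ⟨a, ha, by simp only [e1, Sum.elim_inr]⟩
    · exact Or.inr ⟨a, ha, by simp only [e1, Sum.elim_inl], e2⟩

open Classical in
/-- Choice of absorbers for the vertices `x l` such that the vertices that they release form a path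
from `u` to `z`. -/
theorem IsRich.exists_released_path [Fintype V] [DecidableEq V] (hE : IsRich E d g) {m q₀ : ℕ}
    (y : Fin m → V) (hy : Function.Injective y) (fit : Fin m → V → Prop) (z : V) (r : ℕ) :
    ∀ (I : Finset (Fin m)) (x : ℕ → V) (u : V) (τ : ℕ → Bool), I.card + r + 2 + 2 * g ≤ q₀ →
    (∀ l < r + 2, ∀ b v, q₀ ≤ (Finset.univ.filter fun i => fit i (x l) ∧ E b v (y i)).card) →
    ∃ ι : ℕ → Fin m, (∀ l < r + 2, ∀ l' < r + 2, ι l = ι l' → l = l') ∧ (∀ l < r + 2, ι l ∉ I) ∧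
      (∀ l < r + 2, fit (ι l) (x l)) ∧ E (τ 0) u (y (ι 0)) ∧
      (∀ l, l + 1 < r + 2 → E (τ (l + 1)) (y (ι l)) (y (ι (l + 1)))) ∧
      E (τ (r + 2)) (y (ι (r + 1))) z := by
  induction r with
  | zero =>
    intro I x u τ hI hq
    -- The last two absorbers are chosen together: their released vertices are the ends of an edge
    -- between a set of neighbours of `u` and a set of neighbours of `z`. All earlier ones are
    -- chosen greedily in the induction step.
    have hcard : ∀ l < 2, ∀ b v, 2 * g ≤
        (((Finset.univ.filter fun i => fit i (x l) ∧ E b v (y i)) \ I).image y).card := by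
      intro l hl b v
      rw [Finset.card_image_of_injective _ hy]
      have := hq l hl b v
      have := Finset.le_card_sdiff I (Finset.univ.filter fun i => fit i (x l) ∧ E b v (y i))
      omega
    obtain ⟨a, ha, b, hb, hab, h⟩ := hE.exists_edge_of_two_mul_le (τ 1) _ _
      (le_trans (by omega) (hcard 0 (by omega) (τ 0) u)) (hcard 1 (by omega) (!τ 2) z)
    obtain ⟨i, hi, rfl⟩ := Finset.mem_image.1 ha
    obtain ⟨j, hj, rfl⟩ := Finset.mem_image.1 hb
    simp only [Finset.mem_sdiff, Finset.mem_filter, Finset.mem_univ, true_and] at hi hj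
    have hij : i ≠ j := fun e => hab (e ▸ rfl)
    refine ⟨fun l => if l = 0 then i else j, ?_, ?_, ?_, hi.1.2, ?_, hE.symm' hj.1.2⟩
    · intro l hl l' hl' e
      interval_cases l <;> interval_cases l' <;> simp_all
    · intro l hl
      interval_cases l
      · exact hi.2
      · exact hj.2
    · intro l hl
      interval_cases l
      · exact hi.1.1
      · exact hj.1.1
    · intro l hl
      obtain rfl : l = 0 := by omega
      exact h
  | succ r ih =>
    intro I x u τ hI hq
    obtain ⟨i, hi⟩ : ((Finset.univ.filter fun i => fit i (x 0) ∧ E (τ 0) u (y i)) \ I).Nonempty := by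
      rw [← Finset.card_pos]
      have := hq 0 (by omega) (τ 0) u
      have := Finset.le_card_sdiff I (Finset.univ.filter fun i => fit i (x 0) ∧ E (τ 0) u (y i))
      omega
    simp only [Finset.mem_sdiff, Finset.mem_filter, Finset.mem_univ, true_and] at hi
    obtain ⟨ι, i1, i2, i3, i4, i5, i6⟩ := ih (insert i I) (fun l => x (l + 1)) (y i)
      (fun l => τ (l + 1)) (by
        have := Finset.card_insert_le i I
        omega) (fun l hl => hq (l + 1) (by omega))
    have hne : ∀ l < r + 2, ι l ≠ i := fun l hl e => i2 l hl (by simp [e])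
    refine ⟨fun l => Nat.casesOn l i ι, ?_, ?_, ?_, hi.1.2, ?_, i6⟩
    · intro l hl l' hl' e
      rcases l with _ | l <;> rcases l' with _ | l'
      · rfl
      · exact (hne l' (by omega) e.symm).elim
      · exact (hne l (by omega) e).elim
      · rw [i1 l (by omega) l' (by omega) e]
    · intro l hl
      rcases l with _ | l
      · exact hi.2
      · exact fun hc => i2 l (by omega) (Finset.mem_insert_of_mem hc)
    · intro l hl
      rcases l with _ | l
      · exact hi.1.1
      · exact i3 l (by omega)
    · intro l hl
      rcases l with _ | l
      · exact i4
      · exact i5 l (by omega)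

/-- `f` is a cycle of length `k` with the directions `τ`. -/
structure IsPatternCycle (E : Bool → V → V → Prop) (τ : ℕ → Bool) (k : ℕ) (f : ℕ → V) : Prop where
  injOn : ∀ i < k, ∀ j < k, f i = f j → i = j
  edge : ∀ i, i + 1 < k → E (τ i) (f i) (f (i + 1))
  last : E (τ (k - 1)) (f (k - 1)) (f 0)

open Classical in
/-- Completing an absorbing path to a cycle of length `k`: a long path in the remaining vertices is
joined to the start of the absorbing path through released vertices. -/
theorem IsAbsorbingPath.exists_cycle [Fintype V] [DecidableEq V] (hE : IsRich E d g)
    {τ : ℕ → Bool} {J m q₀ k : ℕ} {q : ℕ → V} {P : Fin m → Fin 3 → ℕ}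
    (hq : IsAbsorbingPath E τ s t (5 * J) q P) (X : Finset V)
    (hX : ∀ x ∈ X, ∃ i < 5 * J, q i = x)
    (hquota : ∀ x ∉ X, ∀ r v, q₀ ≤ (Finset.univ.filter fun i =>
      Fits E s t (q (P i 0)) x (q (P i 0 + 2)) ∧ E r v (q (P i 2 + 1))).card)
    (hq₀ : 5 * g + 2 ≤ q₀) (hJ : 1 ≤ J) (hd : 5 * J + 2 * g ≤ d) (hk : 5 * J + 3 * g + 3 ≤ k)
    (hkn : k ≤ Fintype.card V) : ∃ f, IsPatternCycle E τ k f := by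
  -- The cycle consists of the absorbing path, a searched path on `L` vertices and `3 * g + 2`
  -- released vertices. At least `3 * g` vertices have to be left over by the search, and `hk` gives
  -- `1 ≤ L`.
  obtain ⟨L, rfl⟩ : ∃ L, k = 5 * J + L + (3 * g + 2) := ⟨k - 5 * J - (3 * g + 2), by omega⟩
  set Q := (Finset.range (5 * J)).image q with hQ
  have hQc : Q.card ≤ 5 * J := Finset.card_image_le.trans (by simp)
  have hQm : ∀ i < 5 * J, q i ∈ Q := fun i hi => Finset.mem_image_of_mem _ (by simpa using hi)
  have hZc : L + (3 * g + 2) ≤ (Finset.univ \ Q).card := by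
    have := Finset.le_card_sdiff Q Finset.univ
    rw [Finset.card_univ] at this
    omega
  obtain ⟨p, p1, p2, p3, p4⟩ := hE.exists_long_path (fun i => τ (5 * J + i)) (Finset.univ \ Q)
    (nbr (E (τ (5 * J - 1))) (q (5 * J - 1)) \ Q) L (by omega)
    (Finset.sdiff_subset_sdiff (Finset.subset_univ _) le_rfl) (by
      have := card_sdiff_nbr hE (τ (5 * J - 1)) (q (5 * J - 1)) Q
      omega) (by omega)
  have hpQ : ∀ i < L, p i ∉ Q := fun i hi => (Finset.mem_sdiff.1 (p2 i hi)).2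
  simp only [Finset.mem_sdiff, mem_nbr] at p3
  obtain ⟨T, hT, hTc⟩ := Finset.exists_subset_card_eq (n := 3 * g + 2)
    (s := (Finset.univ \ Q) \ (Finset.range L).image p) (by
      have h1 := Finset.le_card_sdiff ((Finset.range L).image p) (Finset.univ \ Q)
      have h2 : ((Finset.range L).image p).card ≤ L := Finset.card_image_le.trans (by simp)
      omega)
  let x : ℕ → V := fun l => if h : l < 3 * g + 2 then (Finset.equivFinOfCardEq hTc).symm ⟨l, h⟩
    else q 0
  have hxT : ∀ l < 3 * g + 2, x l ∈ T := fun l hl => by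
    simp only [x, dif_pos hl]; exact Subtype.prop _
  have hxi : ∀ l < 3 * g + 2, ∀ l' < 3 * g + 2, x l = x l' → l = l' := by
    intro l hl l' hl' e
    simp only [x, dif_pos hl, dif_pos hl'] at e
    simpa using (Finset.equivFinOfCardEq hTc).symm.injective (Subtype.ext e)
  have hxQ : ∀ l < 3 * g + 2, x l ∉ Q := fun l hl =>
    (Finset.mem_sdiff.1 (Finset.mem_sdiff.1 (hT (hxT l hl))).1).2
  have hxp : ∀ l < 3 * g + 2, ∀ i < L, x l ≠ p i := fun l hl i hi e =>
    (Finset.mem_sdiff.1 (hT (hxT l hl))).2 (Finset.mem_image.2 ⟨i, by simpa using hi, e.symm⟩)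
  have hxX : ∀ l < 3 * g + 2, x l ∉ X := fun l hl hc => by
    obtain ⟨i, hi, e⟩ := hX _ hc
    exact hxQ l hl (e ▸ hQm i hi)
  have hlt : ∀ i v, P i v + 1 < 5 * J := fun i v => by have := hq.lt i v; omega
  obtain ⟨ι, i1, -, i3, i4, i5, i6⟩ := hE.exists_released_path (q₀ := q₀)
    (fun i => q (P i 2 + 1)) (fun i j e => (hq.inj i 2 j 2 (by
      have := hq.injOn _ (hlt i 2) _ (hlt j 2) e
      omega)).1) (fun i x => Fits E s t (q (P i 0)) x (q (P i 0 + 2))) (q 0) (3 * g) ∅ x (p (L - 1))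
    (fun l => τ (5 * J + L - 1 + l)) (by simp; omega) (fun l hl b v => hquota _ (hxX l hl) b v)
  -- The vertex absorbed by absorber `i`; the default applies only to absorbers that are not used.
  let ξ : Fin m → V := fun i => if h : ∃ l < 3 * g + 2, ι l = i then x h.choose else q 0
  have hξ : ∀ l < 3 * g + 2, ξ (ι l) = x l := by
    intro l hl
    have hex : ∃ l' < 3 * g + 2, ι l' = ι l := ⟨l, hl, rfl⟩
    simp only [ξ, dif_pos hex]
    rw [i1 _ hex.choose_spec.1 l hl hex.choose_spec.2]
  have hI : ∀ i, i ∈ (Finset.range (3 * g + 2)).image ι ↔ ∃ l < 3 * g + 2, ι l = i := by simp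
  obtain ⟨q', q1, q2, q3, q4⟩ := hq.exists_swap ((Finset.range (3 * g + 2)).image ι) ξ (by
      intro i hi j hj e
      obtain ⟨l, hl, rfl⟩ := (hI i).1 hi
      obtain ⟨l', hl', rfl⟩ := (hI j).1 hj
      rw [hξ l hl, hξ l' hl'] at e
      rw [hxi l hl l' hl' e]) (by
      intro i hi j hj e
      obtain ⟨l, hl, rfl⟩ := (hI i).1 hi
      rw [hξ l hl] at e
      exact hxQ l hl (e ▸ hQm j hj)) (by
      intro i hi
      obtain ⟨l, hl, rfl⟩ := (hI i).1 hi
      rw [hξ l hl]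
      exact i3 l hl)
  have hq'p : ∀ i < 5 * J, ∀ j < L, q' i ≠ p j := by
    intro i hi j hj e
    rcases q4 i hi with ⟨a, ha, e1⟩ | ⟨j', hj', e1, -⟩
    · obtain ⟨l, hl, rfl⟩ := (hI a).1 ha
      rw [hξ l hl] at e1
      exact hxp l hl j hj (e1.symm.trans e)
    · exact hpQ j hj (e ▸ e1 ▸ hQm j' hj')
  have hq'y : ∀ i < 5 * J, ∀ l < 3 * g + 2, q' i ≠ q (P (ι l) 2 + 1) := by
    intro i hi l hl e
    rcases q4 i hi with ⟨a, ha, e1⟩ | ⟨j', hj', e1, e2⟩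
    · obtain ⟨l', hl', rfl⟩ := (hI a).1 ha
      rw [hξ l' hl'] at e1
      exact hxQ l' hl' (e1 ▸ e ▸ hQm _ (hlt _ _))
    · exact e2 _ ((hI _).2 ⟨l, hl, rfl⟩) (hq.injOn _ hj' _ (hlt _ _) (e1.symm.trans e))
  have hpy : ∀ i < L, ∀ l, p i ≠ q (P (ι l) 2 + 1) := fun i hi l e =>
    hpQ i hi (e ▸ hQm _ (hlt _ _))
  have hyi : ∀ l < 3 * g + 2, ∀ l' < 3 * g + 2, q (P (ι l) 2 + 1) = q (P (ι l') 2 + 1) → l = l' := by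
    intro l hl l' hl' e
    have := hq.injOn _ (hlt _ _) _ (hlt _ _) e
    exact i1 l hl l' hl' (hq.inj _ 2 _ 2 (by omega)).1
  let f : ℕ → V := fun i => if i < 5 * J then q' i else if i < 5 * J + L then p (i - 5 * J) else
    q (P (ι (i - (5 * J + L))) 2 + 1)
  have f1 : ∀ i < 5 * J, f i = q' i := fun i hi => by simp only [f, if_pos hi]
  have f2 : ∀ i < L, f (5 * J + i) = p i := fun i hi => by
    simp only [f, if_neg (show ¬ 5 * J + i < 5 * J by omega),
      if_pos (show 5 * J + i < 5 * J + L by omega)]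
    congr 1; omega
  have f3 : ∀ l, f (5 * J + L + l) = q (P (ι l) 2 + 1) := fun l => by
    simp only [f, if_neg (show ¬ 5 * J + L + l < 5 * J by omega),
      if_neg (show ¬ 5 * J + L + l < 5 * J + L by omega)]
    rw [show 5 * J + L + l - (5 * J + L) = l by omega]
  have split : ∀ i < 5 * J + L + (3 * g + 2), i < 5 * J ∨ (∃ a < L, i = 5 * J + a) ∨
      ∃ l < 3 * g + 2, i = 5 * J + L + l := by
    intro i hi
    by_cases h1 : i < 5 * J
    · exact Or.inl h1
    · by_cases h2 : i < 5 * J + L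
      · exact Or.inr (Or.inl ⟨i - 5 * J, by omega, by omega⟩)
      · exact Or.inr (Or.inr ⟨i - (5 * J + L), by omega, by omega⟩)
  refine ⟨f, ?_, ?_, ?_⟩
  · intro i hi j hj e
    rcases split i hi with hi | ⟨a, ha, rfl⟩ | ⟨l, hl, rfl⟩ <;>
      rcases split j hj with hj | ⟨b, hb, rfl⟩ | ⟨l', hl', rfl⟩
    · rw [f1 i hi, f1 j hj] at e; exact q1 i hi j hj e
    · rw [f1 i hi, f2 b hb] at e; exact (hq'p i hi b hb e).elim
    · rw [f1 i hi, f3] at e; exact (hq'y i hi l' hl' e).elim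
    · rw [f2 a ha, f1 j hj] at e; exact (hq'p j hj a ha e.symm).elim
    · rw [f2 a ha, f2 b hb] at e; rw [p1 ha hb e]
    · rw [f2 a ha, f3] at e; exact (hpy a ha l' e).elim
    · rw [f3, f1 j hj] at e; exact (hq'y j hj l hl e.symm).elim
    · rw [f3, f2 b hb] at e; exact (hpy b hb l e.symm).elim
    · rw [f3, f3] at e; rw [hyi l hl l' hl' e]
  · intro i hi
    rcases split i (by omega) with hi' | ⟨a, ha, rfl⟩ | ⟨l, hl, rfl⟩
    · by_cases h1 : i + 1 < 5 * J
      · rw [f1 i hi', f1 _ h1]; exact q2 i h1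
      -- This position is 4 modulo 5, so the swap leaves the end of the absorbing path unchanged.
      · obtain rfl : i = 5 * J - 1 := by omega
        rw [f1 _ hi', show 5 * J - 1 + 1 = 5 * J + 0 by omega, f2 0 (by omega), q3 _ (by omega)]
        exact p3.1
    · rw [f2 a ha]
      by_cases h1 : a + 1 < L
      · rw [add_assoc, f2 _ h1]; exact p4 a h1
      · obtain rfl : a = L - 1 := by omega
        rw [show 5 * J + (L - 1) + 1 = 5 * J + L + 0 by omega, f3]
        simpa only [show 5 * J + (L - 1) = 5 * J + L - 1 + 0 by omega] using i4
    · rw [f3, add_assoc (5 * J + L) l 1, f3]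
      have := i5 l (by omega)
      rwa [show 5 * J + L - 1 + (l + 1) = 5 * J + L + l by omega] at this
  · rw [show 5 * J + L + (3 * g + 2) - 1 = 5 * J + L + (3 * g + 1) by omega, f3, f1 0 (by omega),
      q3 0 (by simp)]
    rwa [show 5 * J + L - 1 + (3 * g + 2) = 5 * J + L + (3 * g + 1) by omega] at i6

/-! ### Short cycles, and all lengths together. -/

/-- Short cycles are found greedily. -/
theorem IsRich.exists_short_cycle [Fintype V] [DecidableEq V] [Nonempty V] (hE : IsRich E d g)
    (τ : ℕ → Bool) (k : ℕ) (hk : 3 ≤ k) (hd : k + 2 * g ≤ d) : ∃ f, IsPatternCycle E τ k f := by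
  have hg := hE.pos
  obtain ⟨l, rfl⟩ : ∃ l, k = l + 3 := ⟨k - 3, by omega⟩
  have key : ∀ j ≤ l, ∃ p : ℕ → V, (∀ a ≤ j, ∀ b ≤ j, p a = p b → a = b) ∧
      ∀ i < j, E (τ i) (p i) (p (i + 1)) := by
    intro j
    induction j with
    | zero =>
      intro _
      exact ⟨fun _ => Classical.arbitrary V, by intro a ha b hb _; omega, by simp⟩
    | succ j ih =>
      intro hj
      obtain ⟨p, p1, p2⟩ := ih (by omega)
      obtain ⟨x, hx, hx'⟩ := hE.exists_nbr (τ j) (p j) ((Finset.range (j + 1)).image p) (by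
        have : ((Finset.range (j + 1)).image p).card ≤ j + 1 := Finset.card_image_le.trans (by simp)
        omega)
      have hxp : ∀ a ≤ j, p a ≠ x := fun a ha e => hx (Finset.mem_image.2 ⟨a, by simp; omega, e⟩)
      refine ⟨Function.update p (j + 1) x, ?_, ?_⟩
      · intro a ha b hb e
        by_cases h1 : a = j + 1 <;> by_cases h2 : b = j + 1
        · omega
        · subst h1
          rw [Function.update_self, Function.update_of_ne h2] at e
          exact (hxp b (by omega) e.symm).elim
        · subst h2
          rw [Function.update_self, Function.update_of_ne h1] at e
          exact (hxp a (by omega) e).elim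
        · rw [Function.update_of_ne h1, Function.update_of_ne h2] at e
          exact p1 a (by omega) b (by omega) e
      · intro i hi
        rw [Function.update_of_ne (by omega)]
        by_cases h1 : i = j
        · subst h1; simpa using hx'
        · rw [Function.update_of_ne (by omega)]; exact p2 i (by omega)
  obtain ⟨p, p1, p2⟩ := key l le_rfl
  obtain ⟨x, y, hxy, hx, hy, e1, e2, e3⟩ := hE.exists_connection (τ l) (τ (l + 1)) (τ (l + 2)) (p l)
    (p 0) ((Finset.range (l + 1)).image p) (by
      have : ((Finset.range (l + 1)).image p).card ≤ l + 1 := Finset.card_image_le.trans (by simp)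
      omega)
  have hxp : ∀ a ≤ l, p a ≠ x := fun a ha e => hx (Finset.mem_image.2 ⟨a, by simp; omega, e⟩)
  have hyp : ∀ a ≤ l, p a ≠ y := fun a ha e => hy (Finset.mem_image.2 ⟨a, by simp; omega, e⟩)
  let f : ℕ → V := fun i => if i ≤ l then p i else if i = l + 1 then x else y
  have f1 : ∀ i ≤ l, f i = p i := fun i hi => by simp only [f, if_pos hi]
  have f2 : f (l + 1) = x := by simp [f]
  have f3 : f (l + 2) = y := by simp [f]
  refine ⟨f, ?_, ?_, ?_⟩
  · intro i hi j hj e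
    have hi' : i ≤ l ∨ i = l + 1 ∨ i = l + 2 := by omega
    have hj' : j ≤ l ∨ j = l + 1 ∨ j = l + 2 := by omega
    rcases hi' with hi' | rfl | rfl <;> rcases hj' with hj' | rfl | rfl
    · rw [f1 i hi', f1 j hj'] at e; exact p1 i hi' j hj' e
    · rw [f1 i hi', f2] at e; exact (hxp i hi' e).elim
    · rw [f1 i hi', f3] at e; exact (hyp i hi' e).elim
    · rw [f2, f1 j hj'] at e; exact (hxp j hj' e.symm).elim
    · rfl
    · rw [f2, f3] at e; exact (hxy e).elim
    · rw [f3, f1 j hj'] at e; exact (hyp j hj' e.symm).elim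
    · rw [f2, f3] at e; exact (hxy e.symm).elim
    · rfl
  · intro i hi
    have hi' : i < l ∨ i = l ∨ i = l + 1 := by omega
    rcases hi' with hi' | rfl | rfl
    · rw [f1 i hi'.le, f1 (i + 1) hi']; exact p2 i hi'
    · rw [f1 i le_rfl, f2]; exact e1
    · rw [f2, f3]; exact e2
  · rw [show l + 3 - 1 = l + 2 by omega, f3, f1 0 (by omega)]
    exact e3

/-- Rich digraphs contain all oriented cycles of length at least `3`. -/
theorem IsRich.exists_cycle [Fintype V] [DecidableEq V] [Nonempty V] (hE : IsRich E d g)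
    {c m J A e : ℕ} (hA : Fintype.card V ≤ A * d) (hm : 1 ≤ m)
    (h1 : (36 * m + 4) * Fintype.card V < d ^ 2)
    (hbad : ∀ s t, (bad E s t c d).card + m * 3 ≤ J)
    (hJ : 12 * m ≤ J) (hd : 2 * (5 * J + 9 * m + 5 * g + 4) ≤ d)
    (hq : 2 * (Fintype.card V : ℝ) ^ 2 * (1 - 1 / (16 * (A : ℝ) ^ 3)) ^ m <
      (1 / 2 : ℝ) ^ (5 * g + 2))
    (h3 : 2 * (9 * m + 4 + g) ≤ c) (h4 : 4 * (Fintype.card V * e) ≤ c * d) (h5 : 2 * g + 2 ≤ e)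
    (τ : ℕ → Bool) (k : ℕ) (hk : 3 ≤ k) (hkn : k ≤ Fintype.card V) :
    ∃ f, IsPatternCycle E τ k f := by
  classical
  by_cases hkd : k + 2 * g ≤ d
  · exact hE.exists_short_cycle τ k hk hkd
  -- Pigeonhole over the four direction pairs: `12 * m ≤ J` yields `m * 3` blocks with the same
  -- pair.
  obtain ⟨⟨s, t⟩, hst⟩ := Fintype.exists_le_card_fiber_of_mul_le_card
    (f := fun j : Fin J => (τ (5 * j), τ (5 * j + 1))) (n := m * 3) (by simp; omega)
  simp only [Prod.mk.injEq] at hst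
  obtain ⟨L, l1, l2, l3⟩ := hE.exists_absorbers (s := s) (t := t) hA (by omega) h1 (by
    have := hbad s t
    omega) hq h3 h4 h5
  obtain ⟨q, P, hqP, hX, hquota⟩ := hE.exists_absorbingPath (J := J) τ L l1 l2 l3 (by convert hst)
    (hbad s t) (by omega)
  exact hqP.exists_cycle hE _ hX hquota le_rfl (by omega) (by omega) (by omega) hkn

/-! ### From digraphs to pattern cycles. -/

/-- The edge relation of a digraph and its reverse. -/
def dirAdj {V : Type*} (D : Digraph V) (b : Bool) (u v : V) : Prop :=
  if b then D.Adj u v else D.Adj v u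

theorem contains_of_isPatternCycle {V : Type*} {D : Digraph V} {k : ℕ} [NeZero k]
    {σ : ZMod k → Bool} {f : ℕ → V} (hf : IsPatternCycle (dirAdj D) (fun i => σ i) k f) :
    Contains D (cycleDigraph σ) := by
  have hE : ∀ i : ZMod k, dirAdj D (σ i) (f i.val) (f (i + 1).val) := by
    intro i
    have hi := ZMod.val_lt i
    have hcast : ((i.val : ℕ) : ZMod k) = i := by simp
    by_cases h : i.val + 1 < k
    · have h1 : (i + 1).val = i.val + 1 := by
        rw [← ZMod.val_cast_of_lt h]
        congr 1
        push_cast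
        rw [hcast]
      have := hf.edge i.val h
      simp only [hcast] at this
      rwa [h1]
    · have h1 : (i + 1).val = 0 := by
        rw [ZMod.val_eq_zero]
        have h2 : ((i.val + 1 : ℕ) : ZMod k) = 0 := by
          rw [show i.val + 1 = k by omega]; simp
        push_cast at h2
        rwa [hcast] at h2
      have := hf.last
      rw [show k - 1 = i.val by omega] at this
      simp only [hcast] at this
      rwa [h1]
  refine ⟨⟨fun i => f i.val, fun i j h => ZMod.val_injective k
    (hf.injOn _ (ZMod.val_lt i) _ (ZMod.val_lt j) h)⟩, ?_⟩
  rintro u v ⟨i, hi⟩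
  have h := hE i
  simp only [cycleEdge] at hi
  show D.Adj (f u.val) (f v.val)
  split_ifs at hi with hσ <;> simp only [Prod.mk.injEq] at hi <;> rw [← hi.1, ← hi.2] <;>
    simpa [dirAdj, hσ] using h

theorem contains_two {V : Type*} {D : Digraph V} {x y : V} (hxy : x ≠ y) (h : D.Adj x y)
    (h' : D.Adj y x) (σ : ZMod 2 → Bool) : Contains D (cycleDigraph σ) := by
  have hadj : ∀ a b : ZMod 2, a ≠ b → D.Adj (if a = 0 then x else y) (if b = 0 then x else y) := by
    intro a b hab
    fin_cases a <;> fin_cases b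
    · exact (hab rfl).elim
    · exact h
    · exact h'
    · exact (hab rfl).elim
  refine ⟨⟨fun a => if a = 0 then x else y, ?_⟩, ?_⟩
  · intro a b e
    fin_cases a <;> fin_cases b
    · rfl
    · exact (hxy e).elim
    · exact (hxy e.symm).elim
    · rfl
  · rintro u v ⟨i, hi⟩
    apply hadj
    rintro rfl
    simp only [cycleEdge] at hi
    have h01 : ∀ i : ZMod 2, i ≠ i + 1 := by decide
    split_ifs at hi <;> simp only [Prod.mk.injEq] at hi
    · exact h01 i (hi.1.trans hi.2.symm)
    · exact h01 i (hi.2.trans hi.1.symm)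

theorem minSemidegree_le_outDegree {V : Type*} [Finite V] (D : Digraph V) (v : V) :
    minSemidegree D ≤ outDegree D v :=
  (ciInf_le (OrderBot.bddBelow _) v).trans (min_le_left _ _)

theorem minSemidegree_le_inDegree {V : Type*} [Finite V] (D : Digraph V) (v : V) :
    minSemidegree D ≤ inDegree D v :=
  (ciInf_le (OrderBot.bddBelow _) v).trans (min_le_right _ _)

/-- `D` supplies the degrees and `R` the edges between large sets; for the reversed direction `A`
and `B` exchange roles. -/
theorem isRich_dirAdj {V : Type*} [Fintype V] (D R : Digraph V) {g : ℕ} (hg : 1 ≤ g)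
    (hR : ∀ A B : Finset V, Disjoint A B → g ≤ A.card → g ≤ B.card → ∃ a ∈ A, ∃ b ∈ B, R.Adj a b) :
    IsRich (dirAdj (D ⊔ R)) (minSemidegree D) g where
  symm := by
    intro s u v h
    cases s <;> simpa [dirAdj] using h
  le_degree := by
    classical
    intro s u
    cases s
    · refine (minSemidegree_le_inDegree D u).trans ?_
      rw [inDegree, ← Set.ncard_coe_finset]
      refine Set.ncard_le_ncard (fun w hw => ?_) (Set.toFinite _)
      simp only [Finset.mem_coe, mem_nbr, dirAdj]
      exact Or.inl hw
    · refine (minSemidegree_le_outDegree D u).trans ?_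
      rw [outDegree, ← Set.ncard_coe_finset]
      refine Set.ncard_le_ncard (fun w hw => ?_) (Set.toFinite _)
      simp only [Finset.mem_coe, mem_nbr, dirAdj]
      exact Or.inl hw
  exists_edge := by
    intro s A B hAB hA hB
    cases s
    · obtain ⟨b, hb, a, ha, h⟩ := hR B A hAB.symm hB hA
      exact ⟨a, ha, b, hb, Or.inr h⟩
    · obtain ⟨a, ha, b, hb, h⟩ := hR A B hAB hA hB
      exact ⟨a, ha, b, hb, Or.inr h⟩
  pos := hg

/-! ### Choice of the constants. -/

/-- As `320 = 16 * 20`, the power on the left is at most `exp (-20 g)`, while the right side is at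
least `exp (-(5 g + 2))`. The gap exceeds `2 * n ^ 2` because `n ^ 2 ≤ M ^ 2 * g ^ 2 ≤ g ^ 3`. -/
theorem potential_lt {A M n g : ℕ} (hA : 1 ≤ A) (hg1 : 1 ≤ g) (hng : n ≤ M * g) (hgM : M ^ 2 ≤ g) :
    2 * (n : ℝ) ^ 2 * (1 - 1 / (16 * (A : ℝ) ^ 3)) ^ (320 * A ^ 3 * g) <
      (1 / 2 : ℝ) ^ (5 * g + 2) := by
  have hA0 : (0 : ℝ) < A := by exact_mod_cast hA
  have h1 : (1 - 1 / (16 * (A : ℝ) ^ 3)) ^ (320 * A ^ 3 * g) ≤ Real.exp (-(20 * g)) := by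
    have e1 : 1 - 1 / (16 * (A : ℝ) ^ 3) ≤ Real.exp (-(1 / (16 * (A : ℝ) ^ 3))) := by
      have := Real.add_one_le_exp (-(1 / (16 * (A : ℝ) ^ 3)))
      linarith
    have e0 : 0 ≤ 1 - 1 / (16 * (A : ℝ) ^ 3) := by
      have hA1 : (1 : ℝ) ≤ (A : ℝ) ^ 3 := one_le_pow₀ (by exact_mod_cast hA)
      rw [sub_nonneg, div_le_one (by positivity)]
      linarith
    refine (pow_le_pow_left₀ e0 e1 _).trans (le_of_eq ?_)
    rw [← Real.exp_nat_mul]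
    congr 1
    push_cast
    field_simp
    ring
  have h2 : Real.exp (-(5 * g + 2)) ≤ (1 / 2 : ℝ) ^ (5 * g + 2) := by
    have : Real.exp (-1) ≤ 1 / 2 := by
      rw [Real.exp_neg, ← one_div]
      refine one_div_le_one_div_of_le (by norm_num) ?_
      have := Real.add_one_le_exp (1 : ℝ)
      linarith
    refine le_trans (le_of_eq ?_) (pow_le_pow_left₀ (Real.exp_pos _).le this _)
    rw [← Real.exp_nat_mul]
    congr 1
    push_cast
    ring
  have hgR : (1 : ℝ) ≤ g := by exact_mod_cast hg1
  have hngR : (n : ℝ) ≤ M * g := by exact_mod_cast hng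
  have hgMR : (M : ℝ) ^ 2 ≤ g := by exact_mod_cast hgM
  have h3 : 2 * (n : ℝ) ^ 2 < Real.exp (15 * g - 2) := by
    have e1 : Real.exp (13 * g) ≤ Real.exp (15 * g - 2) := Real.exp_le_exp.2 (by linarith)
    have e2 : Real.exp (13 * g) = Real.exp g * Real.exp g * Real.exp (11 * g) := by
      rw [← Real.exp_add, ← Real.exp_add]; ring_nf
    have e3 : (g : ℝ) ≤ Real.exp g := by have := Real.add_one_le_exp (g : ℝ); linarith
    have e4 : 11 * (g : ℝ) ≤ Real.exp (11 * g) := by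
      have := Real.add_one_le_exp (11 * (g : ℝ)); linarith
    have e5 : (g : ℝ) * g ≤ Real.exp g * Real.exp g := by gcongr
    have e6 : (n : ℝ) ^ 2 ≤ (M * g) ^ 2 := by gcongr
    calc 2 * (n : ℝ) ^ 2 ≤ ((g : ℝ) * g) * (2 * (M : ℝ) ^ 2) := by nlinarith
      _ < ((g : ℝ) * g) * (11 * g) := by
          refine mul_lt_mul_of_pos_left ?_ (by positivity)
          linarith
      _ ≤ (Real.exp g * Real.exp g) * Real.exp (11 * g) := by gcongr
      _ ≤ _ := by rw [← e2]; exact e1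
  calc 2 * (n : ℝ) ^ 2 * (1 - 1 / (16 * (A : ℝ) ^ 3)) ^ (320 * A ^ 3 * g)
      ≤ 2 * (n : ℝ) ^ 2 * Real.exp (-(20 * g)) := by gcongr
    _ < Real.exp (15 * g - 2) * Real.exp (-(20 * g)) :=
        mul_lt_mul_of_pos_right h3 (Real.exp_pos _)
    _ = Real.exp (-(5 * g + 2)) := by rw [← Real.exp_add]; ring_nf
    _ ≤ _ := h2

/-- For `M` large in terms of `A`, digraphs on `n ≥ M ^ 3` vertices that have degrees at least `n / A`
and edges between any two disjoint sets of size `n / M + 1` contain all oriented cycles. -/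
theorem exists_cycle_of_large (A : ℕ) (hA : 1 ≤ A) : ∃ M : ℕ, A ≤ M ∧ ∀ n d : ℕ, M ^ 3 ≤ n → n ≤ A * d →
    ∀ {V : Type} [Fintype V] [DecidableEq V] [Nonempty V] {E : Bool → V → V → Prop},
    Fintype.card V = n → IsRich E d (n / M + 1) →
    ∀ (τ : ℕ → Bool) (k : ℕ), 3 ≤ k → k ≤ n → ∃ f, IsPatternCycle E τ k f := by
  -- All parameters are multiples of `g`: `m = M₂ * g`, `c = C₁ * g`, `J = J₁ * g`. Here `C₁` leaves
  -- room for the gadgets, `J₁` covers the bound `2 * A ^ 2 * C₁ * g` on the bad vertices and the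
  -- `12 * m` for pigeonhole, and `D₁ * g ≤ d` is what the construction demands of the degree.
  -- Finally `M` makes `g` small compared with `d`.
  obtain ⟨M₂, hM₂⟩ : ∃ M₂, M₂ = 320 * A ^ 3 := ⟨_, rfl⟩
  obtain ⟨C₁, hC₁⟩ : ∃ C₁, C₁ = 2 * (9 * M₂ + 5) := ⟨_, rfl⟩
  obtain ⟨J₁, hJ₁⟩ : ∃ J₁, J₁ = 2 * A ^ 2 * C₁ + 12 * M₂ := ⟨_, rfl⟩
  obtain ⟨D₁, hD₁⟩ : ∃ D₁, D₁ = 2 * (5 * J₁ + 9 * M₂ + 9) := ⟨_, rfl⟩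
  obtain ⟨M, hM⟩ : ∃ M, M = 2 * A * D₁ + 2 * A ^ 2 * (36 * M₂ + 4) + 1 := ⟨_, rfl⟩
  have hAM : A ≤ M := by nlinarith
  refine ⟨M, hAM, ?_⟩
  intro n d hn hnd V _ _ _ E hV hE τ k hk hkn
  have hM1 : 1 ≤ M := by omega
  have hM3 : M ≤ M ^ 3 := Nat.le_self_pow (by norm_num) M
  obtain ⟨g, hg⟩ : ∃ g, g = n / M + 1 := ⟨_, rfl⟩
  rw [← hg] at hE
  have hg1 : 1 ≤ g := hg ▸ Nat.le_add_left 1 _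
  have hng : n ≤ M * g := by
    have := Nat.div_add_mod n M
    have := Nat.mod_lt n (show 0 < M by omega)
    rw [hg, mul_add]; omega
  have hgn : M * g ≤ 2 * n := by
    have := Nat.mul_div_le n M
    rw [hg, mul_add]; omega
  have hgM : M ^ 2 ≤ g := by
    by_contra hlt
    push Not at hlt
    have : n / M < M ^ 2 := by omega
    rw [Nat.div_lt_iff_lt_mul (by omega)] at this
    have e : M ^ 2 * M = M ^ 3 := by ring
    omega
  have hd0 : 0 < d := by
    rcases Nat.eq_zero_or_pos d with h | h
    · subst h; omega
    · exact h
  have hgd : M * g ≤ 2 * A * d := by nlinarith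
  have hD₁d : D₁ * g ≤ d := by
    have h1 : 2 * A * D₁ * g ≤ M * g := Nat.mul_le_mul_right _ (by omega)
    have h2 : 2 * A * (D₁ * g) ≤ 2 * A * d := by nlinarith
    exact Nat.le_of_mul_le_mul_left h2 (by omega)
  have hd2 : A * ((36 * M₂ + 4) * g) < d := by
    have h1 : (2 * A ^ 2 * (36 * M₂ + 4) + 1) * g ≤ M * g := Nat.mul_le_mul_right _ (by omega)
    have h2 : 2 * A * (A * ((36 * M₂ + 4) * g)) < 2 * A * d := by nlinarith
    exact Nat.lt_of_mul_lt_mul_left h2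
  refine hE.exists_cycle (c := C₁ * g) (m := M₂ * g) (J := J₁ * g) (A := A) (e := 4 * g)
    (by rw [hV]; exact hnd) ?_ ?_ ?_ ?_ ?_ ?_ ?_ ?_ (by omega) τ k hk (by omega)
  · have : 1 ≤ A ^ 3 := Nat.one_le_pow _ _ hA
    nlinarith
  · rw [hV]
    calc (36 * (M₂ * g) + 4) * n ≤ ((36 * M₂ + 4) * g) * (A * d) :=
          Nat.mul_le_mul (by rw [add_mul, mul_assoc]; omega) hnd
      _ = (A * ((36 * M₂ + 4) * g)) * d := by ring
      _ < d * d := Nat.mul_lt_mul_of_pos_right hd2 hd0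
      _ = d ^ 2 := by ring
  · intro s t
    have h1 := hE.card_bad s t (C₁ * g)
    rw [hV] at h1
    have h2 : 2 * n ^ 2 * (C₁ * g) ≤ (2 * A ^ 2 * C₁ * g) * d ^ 2 := by
      calc 2 * n ^ 2 * (C₁ * g) ≤ 2 * (A * d) ^ 2 * (C₁ * g) :=
            Nat.mul_le_mul_right _ (Nat.mul_le_mul_left _ (Nat.pow_le_pow_left hnd 2))
        _ = _ := by ring
    have h3 : (bad E s t (C₁ * g) d).card ≤ 2 * A ^ 2 * C₁ * g :=
      Nat.le_of_mul_le_mul_right (h1.trans h2) (by positivity)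
    have h4 : J₁ * g = 2 * A ^ 2 * C₁ * g + 12 * (M₂ * g) := by rw [hJ₁]; ring
    omega
  · have h4 : J₁ * g = 2 * A ^ 2 * C₁ * g + 12 * (M₂ * g) := by rw [hJ₁]; ring
    rw [h4]
    exact Nat.le_add_left _ _
  · refine le_trans ?_ hD₁d
    have h4 : D₁ * g = 10 * (J₁ * g) + 18 * (M₂ * g) + 18 * g := by rw [hD₁]; ring
    omega
  · rw [hV]
    subst hM₂
    exact potential_lt hA hg1 hng hgM
  · have h4 : C₁ * g = 18 * (M₂ * g) + 10 * g := by rw [hC₁]; ring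
    omega
  · rw [hV]
    have h1 : 16 * A ≤ C₁ := by
      have : A ≤ A ^ 3 := Nat.le_self_pow (by norm_num) A
      omega
    calc 4 * (n * (4 * g)) = 16 * n * g := by ring
      _ ≤ 16 * (A * d) * g := by gcongr
      _ = (16 * A) * (g * d) := by ring
      _ ≤ C₁ * (g * d) := Nat.mul_le_mul_right _ h1
      _ = C₁ * g * d := by ring

/-! ### The random digraph and the theorem. -/

/-- The probability that a random set avoids `S`. -/
theorem setBernoulli_real_avoid {ι : Type*} {u : Set ι} (p : unitInterval) (S : Finset ι)
    (hS : ∀ i ∈ S, i ∈ u) :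
    (setBernoulli u p).real {s | ∀ i ∈ S, i ∉ s} = (1 - (p : ℝ)) ^ S.card := by
  have h1 : ((fun p : ι → Prop => {i | p i}) ⁻¹' {s : Set ι | ∀ i ∈ S, i ∉ s}) =
      Set.pi (S : Set ι) (fun _ => {False}) := by
    ext f
    simp [Set.mem_pi]
  rw [measureReal_def, setBernoulli_apply', h1, Measure.infinitePi_pi _ (fun _ _ => by measurability),
    Finset.prod_congr rfl (g := fun _ => ((unitInterval.toNNReal (unitInterval.symm p) : NNReal) : ENNReal))]
  · simp
  · intro i hi
    simp [hS i hi]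

open Classical in
/-- With high probability, the random digraph has an edge in `S` and edges between any two disjoint
sets of size `g`. -/
theorem one_sub_le_binomialDigraph {V : Type*} [Fintype V] {p : unitInterval}
    {g N : ℕ} {S : Finset (V × V)} (hS : ∀ e ∈ S, e.1 ≠ e.2) (hN : N ≤ S.card) (T : Set (Digraph V))
    (hT : ∀ R : Digraph V, (∀ A B : Finset V, Disjoint A B → g ≤ A.card → g ≤ B.card →
      ∃ a ∈ A, ∃ b ∈ B, R.Adj a b) → (∃ e ∈ S, R.Adj e.1 e.2) → R ∈ T) :
    1 - (4 ^ Fintype.card V * Real.exp (-(p * (g * g : ℕ))) + Real.exp (-(p * N))) ≤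
      (binomialDigraph V p).real T := by
  have hmeas : Measurable (ofEdgeSet : Set (V × V) → Digraph V) := by
    rw [measurable_comap_iff]
    exact measurable_id
  have hp0 : (0 : ℝ) ≤ 1 - p := by have := p.2.2; linarith
  have hbound : ∀ (S : Finset (V × V)) (N : ℕ), (∀ e ∈ S, e.1 ≠ e.2) → N ≤ S.card →
      (setBernoulli {e : V × V | e.1 ≠ e.2} p).real {s | ∀ e ∈ S, e ∉ s} ≤
        Real.exp (-(p * N)) := by
    intro S N hS hN
    rw [setBernoulli_real_avoid (u := {e : V × V | e.1 ≠ e.2}) p S hS]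
    calc (1 - (p : ℝ)) ^ S.card ≤ (1 - (p : ℝ)) ^ N :=
          pow_le_pow_of_le_one hp0 (by have := p.2.1; linarith) hN
      _ ≤ Real.exp (-p) ^ N := pow_le_pow_left₀ hp0 (by
          have := Real.add_one_le_exp (-(p : ℝ)); linarith) _
      _ = _ := by rw [← Real.exp_nat_mul]; ring_nf
  set P : Finset (Finset V × Finset V) := Finset.univ.filter fun z =>
    Disjoint z.1 z.2 ∧ g ≤ z.1.card ∧ g ≤ z.2.card with hP
  set μ := setBernoulli {e : V × V | e.1 ≠ e.2} p with hμ
  have hsub : (Set.univ : Set (Set (V × V))) ⊆ (ofEdgeSet ⁻¹' T) ∪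
      ((⋃ z ∈ P, {s | ∀ e ∈ z.1 ×ˢ z.2, e ∉ s}) ∪ {s | ∀ e ∈ S, e ∉ s}) := by
    intro s _
    by_contra hc
    simp only [Set.mem_union, not_or, Set.mem_preimage, Set.mem_iUnion, not_exists] at hc
    obtain ⟨h1, h2, h3⟩ := hc
    refine h1 (hT _ ?_ ?_)
    · intro A B hAB hA hB
      by_contra hcc
      push Not at hcc
      refine h2 (A, B) (by simp [hP, hAB, hA, hB]) ?_
      intro e he hes
      exact hcc e.1 (Finset.mem_product.1 he).1 e.2 (Finset.mem_product.1 he).2 hes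
    · by_contra hcc
      push Not at hcc
      exact h3 fun e he hes => hcc e he hes
  have h1 : 1 ≤ μ.real (ofEdgeSet ⁻¹' T) +
      (∑ z ∈ P, μ.real {s | ∀ e ∈ z.1 ×ˢ z.2, e ∉ s} + μ.real {s | ∀ e ∈ S, e ∉ s}) := by
    calc (1 : ℝ) = μ.real Set.univ := by simp [hμ]
      _ ≤ _ := measureReal_mono hsub
      _ ≤ _ := measureReal_union_le _ _
      _ ≤ _ := by
          gcongr
          refine (measureReal_union_le _ _).trans ?_
          gcongr
          exact measureReal_biUnion_finset_le _ _
  have h2 : ∑ z ∈ P, μ.real {s | ∀ e ∈ z.1 ×ˢ z.2, e ∉ s} ≤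
      4 ^ Fintype.card V * Real.exp (-(p * (g * g : ℕ))) := by
    calc ∑ z ∈ P, μ.real {s | ∀ e ∈ z.1 ×ˢ z.2, e ∉ s}
        ≤ P.card • Real.exp (-(p * (g * g : ℕ))) := by
          refine Finset.sum_le_card_nsmul _ _ _ fun z hz => ?_
          simp only [hP, Finset.mem_filter, Finset.mem_univ, true_and] at hz
          refine hbound _ _ ?_ ?_
          · rintro ⟨a, b⟩ he
            rw [Finset.mem_product] at he
            exact fun e : a = b => Finset.disjoint_left.1 hz.1 he.1 (e ▸ he.2)
          · rw [Finset.card_product]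
            exact Nat.mul_le_mul hz.2.1 hz.2.2
      _ ≤ _ := by
          rw [nsmul_eq_mul]
          refine mul_le_mul_of_nonneg_right ?_ (Real.exp_pos _).le
          have : P.card ≤ 4 ^ Fintype.card V := by
            refine (Finset.card_le_univ _).trans (le_of_eq ?_)
            rw [Fintype.card_prod, Fintype.card_finset, ← mul_pow]
            norm_num
          exact_mod_cast this
  have h3 := hbound S N hS hN
  -- This inequality holds for arbitrary `T`, so measurability of the event need not be checked.
  have h4 : μ.real (ofEdgeSet ⁻¹' T) ≤ (binomialDigraph V p).real T := by
    have : IsProbabilityMeasure (binomialDigraph V p) :=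
      Measure.isProbabilityMeasure_map hmeas.aemeasurable
    exact ENNReal.toReal_mono (measure_ne_top _ _)
      (Measure.le_map_apply hmeas.aemeasurable T)
  linarith

-- Summing indegrees bounds from below the number of pairs whose reverse is an edge of `D`; any
-- random edge among them creates a cycle of length 2.
open Classical in
theorem card_mul_minSemidegree_le {V : Type*} [Fintype V] (D : Digraph V) :
    Fintype.card V * minSemidegree D ≤
      (Finset.univ.filter fun e : V × V => D.Adj e.2 e.1).card := by
  rw [Finset.card_filter, Fintype.sum_prod_type, ← Finset.card_univ, ← smul_eq_mul]
  refine Finset.card_nsmul_le_sum _ _ _ fun v _ => ?_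
  rw [← Finset.card_filter]
  refine (minSemidegree_le_inDegree D v).trans (le_of_eq ?_)
  rw [inDegree, ← Set.ncard_coe_finset]
  simp

end PerturbedDigraph

theorem theorem1p3 (α : ℝ) (hα : 0 < α) :
    ∃ C : ℝ, 0 < C ∧
      ∀ ε : ℝ, 0 < ε → ∃ N : ℕ, ∀ n : ℕ, N ≤ n →
        ∀ D₀ : Digraph (Fin n), PerturbedDigraph.Loopless D₀ →
          α * (n : ℝ) ≤ (PerturbedDigraph.minSemidegree D₀ : ℝ) →
          1 - ε ≤ (PerturbedDigraph.binomialDigraph (Fin n)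
              (PerturbedDigraph.edgeProb C n)).real
            {R : Digraph (Fin n) | PerturbedDigraph.ContainsAllOrientedCycles (D₀ ⊔ R) n} := by
  classical
  set A := ⌈1 / α⌉₊ with hA
  have hA1 : 1 ≤ A := Nat.one_le_ceil_iff.2 (by positivity)
  have hAα : 1 ≤ A * α := by
    have := Nat.le_ceil (1 / α)
    rwa [div_le_iff₀ hα] at this
  obtain ⟨M, hAM, hM⟩ := PerturbedDigraph.exists_cycle_of_large A hA1
  have hM1 : (1 : ℝ) ≤ M := by exact_mod_cast hA1.trans hAM
  -- With `p = 3 * M ^ 2 / n` and `n ≤ M * g`, one gets `p * g ^ 2 ≥ 3 * n`, which beats the `4 ^ n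
  -- ≤ exp (2 n)` pairs of sets.
  refine ⟨3 * (M : ℝ) ^ 2, by positivity, fun ε hε => ?_⟩
  -- The three bounds serve the deterministic part, make `C / n ≤ 1` so that nothing is cut off, and
  -- bring the failure probability `2 * exp (-n)` below `ε`.
  refine ⟨max (M ^ 3) (max (3 * M ^ 2) ⌈2 / ε⌉₊), fun n hn D₀ hD₀ hdeg => ?_⟩
  simp only [max_le_iff] at hn
  obtain ⟨hn1, hn2, hn3⟩ := hn
  have hn0 : 0 < n := lt_of_lt_of_le (by have := hA1.trans hAM; positivity) hn1
  have hnR : (0 : ℝ) < n := by exact_mod_cast hn0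
  have : NeZero n := ⟨hn0.ne'⟩
  set d := PerturbedDigraph.minSemidegree D₀ with hd
  have hnd' : (n : ℝ) ≤ A * d := by nlinarith
  have hnd : n ≤ A * d := by exact_mod_cast hnd'
  set p := PerturbedDigraph.edgeProb (3 * (M : ℝ) ^ 2) n with hp
  have hpv : (p : ℝ) = 3 * (M : ℝ) ^ 2 / n := by
    rw [hp, PerturbedDigraph.edgeProb, Set.projIcc_of_mem zero_le_one
      ⟨by positivity, by rw [div_le_one hnR]; exact_mod_cast hn2⟩]
  set g := n / M + 1 with hg
  have hgn : (n : ℝ) ≤ M * g := by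
    have h1 := Nat.div_add_mod n M
    have h2 := Nat.mod_lt n (show 0 < M by omega)
    have : n ≤ M * g := by rw [hg, mul_add]; omega
    exact_mod_cast this
  have key := PerturbedDigraph.one_sub_le_binomialDigraph (V := Fin n) (p := p) (g := g)
    (N := n * d) (S := Finset.univ.filter fun e : Fin n × Fin n => D₀.Adj e.2 e.1)
    (by
      rintro ⟨a, b⟩ he (rfl : a = b)
      exact hD₀ a (by simpa using he))
    (by simpa using PerturbedDigraph.card_mul_minSemidegree_le D₀)
    {R : Digraph (Fin n) | PerturbedDigraph.ContainsAllOrientedCycles (D₀ ⊔ R) n} (by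
      rintro R hR ⟨⟨x, y⟩, he, hxy⟩ k hk2 hkn σ -
      simp only [Finset.mem_filter, Finset.mem_univ, true_and] at he
      rcases hk2.eq_or_lt with rfl | hk3
      · exact PerturbedDigraph.contains_two (x := x) (y := y) (by rintro rfl; exact hD₀ _ he) (Or.inr hxy)
          (Or.inl he) σ
      · have : NeZero k := ⟨by omega⟩
        obtain ⟨f, hf⟩ := hM n d hn1 hnd (by simp)
          (PerturbedDigraph.isRich_dirAdj D₀ R (Nat.le_add_left 1 _) hR) (fun i => σ i) k hk3 hkn
        exact PerturbedDigraph.contains_of_isPatternCycle hf)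
  refine le_trans ?_ key
  have h1 : (4 : ℝ) ^ Fintype.card (Fin n) * Real.exp (-(p * (g * g : ℕ))) ≤ Real.exp (-n) := by
    have e1 : (4 : ℝ) ^ n ≤ Real.exp (2 * n) := by
      have : (2 : ℝ) ≤ Real.exp 1 := by have := Real.add_one_le_exp (1 : ℝ); linarith
      calc (4 : ℝ) ^ n = (2 * 2) ^ n := by norm_num
        _ ≤ (Real.exp 1 * Real.exp 1) ^ n := by gcongr
        _ = _ := by rw [← Real.exp_add, ← Real.exp_nat_mul]; ring_nf
    have e2 : 3 * (n : ℝ) ≤ p * (g * g : ℕ) := by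
      rw [hpv, div_mul_eq_mul_div, le_div_iff₀ hnR]
      push_cast
      nlinarith
    rw [Fintype.card_fin]
    calc (4 : ℝ) ^ n * Real.exp (-(p * (g * g : ℕ))) ≤ Real.exp (2 * n) * Real.exp (-(3 * n)) := by
          gcongr
      _ = _ := by rw [← Real.exp_add]; ring_nf
  have h2 : Real.exp (-(p * (n * d : ℕ))) ≤ Real.exp (-n) := by
    rw [Real.exp_le_exp, neg_le_neg_iff, hpv]
    push_cast
    have e : 3 * (M : ℝ) ^ 2 / n * (n * d) = 3 * (M : ℝ) ^ 2 * d := by field_simp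
    rw [e]
    have hAMR : (A : ℝ) ≤ M := by exact_mod_cast hAM
    refine hnd'.trans (mul_le_mul_of_nonneg_right ?_ (Nat.cast_nonneg _))
    nlinarith
  have h3 : 2 * Real.exp (-n) ≤ ε := by
    have e1 : 2 / ε ≤ n := (Nat.le_ceil _).trans (by exact_mod_cast hn3)
    have e2 := Real.add_one_le_exp (n : ℝ)
    rw [Real.exp_neg, ← div_eq_mul_inv, div_le_iff₀ (Real.exp_pos _)]
    rw [div_le_iff₀ hε] at e1
    nlinarith
  linarith
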